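/- Let $\mathcal H$ be a finite-dimensional smooth manifold (possibly with boundary). Null hypersurface data $\mathcal D=\{\mathcal H,\gamma,\ell,\ell^{(2)},Y\}$ consist of smooth symmetric two-covariant tensor fields $\gamma, Y$, a smooth one-form $\ell$ and a smooth function $\ell^{(2)}$ on $\mathcal H$ such that at every $p\in\mathcal H$ the symmetric bilinear form $$\mathcal A|_p\big((W,a),(Z,b)\big)=\gamma(W,Z)+a\,\ell(Z)+b\,\ell(W)+ab\,\ell^{(2)}$$ on $T_p\mathcal H\times\mathbb R$ is non-degenerate and $n^{(2)}=0$, where $(n,n^{(2)})\in T_p\mathcal H\times\mathbb R$ is the vector with $\mathcal A((n,n^{(2)}),(Z,b))=b$ for all $(Z,b)$. Put $K=n^{(2)}Y+\tfrac12\mathcal L_n\gamma+\ell\otimes_s dn^{(2)}$ and $F=\tfrac12 d\ell$, and let $\overline\nabla$ be the torsion-free connection determined by $$(\overline\nabla_X\gamma)(Z,W)=-\ell(Z)K(X,W)-\ell(W)K(X,Z),\qquad (\overline\nabla_X\ell)(Z)=Y(X,Z)+F(X,Z)-\ell^{(2)}K(X,Z),$$ with curvature $\overline R^a{}_{bcd}$,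 where $\overline R(e_c,e_d)e_b=\overline R^a{}_{bcd}e_a$ and $\overline R(X,Y)Z=\overline\nabla_X\overline\nabla_YZ-\overline\nabla_Y\overline\nabla_XZ-\overline\nabla_{[X,Y]}Z$. Define the tensors $$A_{bcd}=\ell_a\overline R^a{}_{bcd}+2\ell^{(2)}\overline\nabla_{[d}K_{c]b}+K_{b[c}\overline\nabla_{d]}\ell^{(2)},\qquad B_{abcd}=\gamma_{af}\overline R^f{}_{bcd}+2\overline\nabla_{[d}\big(K_{c]b}\ell_a\big)+2\ell^{(2)}K_{b[c}K_{d]a}$$ (brackets denote antisymmetrization with weight $\tfrac12$). Let $z$ be a smooth nowhere vanishing function and $\zeta$ a smooth vector field on $\mathcal H$, and let $\mathcal D'=\mathcal G_{(z,\zeta)}\mathcal D$ be the gauge transformed data $$\gamma'=\gamma,\quad \ell'=z\big(\ell+\gamma(\zeta,\cdot)\big),\quad \ell^{(2)\prime}=z^2\big(\ell^{(2)}+2\ell(\zeta)+\gamma(\zeta,\zeta)\big),\quad Y'=zY+\ell\otimes_s dz+\tfrac12\mathcal L_{z\zeta}\gamma .$$ Then the tensors $A',B'$ constructed in the same way from $\mathcal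 D'$ satisfy $$A'=z\,(A+i_\zeta B),\qquad B'=B,$$ that is, $A'_{bcd}=z(A_{bcd}+\zeta^aB_{abcd})$ and $B'_{abcd}=B_{abcd}$. -/

import Mathlib

open Bundle
open scoped Manifold ContDiff

noncomputable section

namespace HypersurfaceData

variable {E : Type*} [NormedAddCommGroup E] [NormedSpace ℝ E]
  {H : Type*} [TopologicalSpace H] {I : ModelWithCorners ℝ E H}
  {M : Type*} [TopologicalSpace M] [ChartedSpace H M]

/-! ### Vector fields and covariant tensor fields -/

variable (I M) in
/-- (Rough) vector fields on `M`; regularity is imposed separately. -/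
abbrev VField : Type _ := Π p : M, TangentSpace I p

variable (I M) in
/-- (Rough) one-forms on `M`. -/
abbrev OneForm : Type _ := Π p : M, TangentSpace I p →L[ℝ] ℝ

variable (I M) in
/-- (Rough) two-covariant tensor fields on `M`. -/
abbrev TwoTensor : Type _ := Π p : M, TangentSpace I p →L[ℝ] TangentSpace I p →L[ℝ] ℝ

variable (I M) in
/-- Operators `X ↦ (v ↦ ∇_v X)` on vector fields. The argument order is that of Mathlib:
`cov X p v` is `∇_v X` at `p`. -/
abbrev VFieldOperator : Type _ :=
  VField I M → Π p : M, TangentSpace I p →L[ℝ] TangentSpace I p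

/-- The vector field `X` is differentiable at `p`. -/
abbrev VField.DiffAt [IsManifold I ∞ M] (X : VField I M) (p : M) : Prop :=
  MDifferentiableAt I (I.prod 𝓘(ℝ, E)) (fun q ↦ TotalSpace.mk' E q (X q)) p

/-- The vector field `X` is smooth at (that is, around) `p`. -/
abbrev VField.SmoothAt [IsManifold I ∞ M] (X : VField I M) (p : M) : Prop :=
  ContMDiffAt I (I.prod 𝓘(ℝ, E)) ∞ (fun q ↦ TotalSpace.mk' E q (X q)) p

/-- The vector field `X` is smooth, `X ∈ Γ(TM)`. -/
abbrev VField.Smooth [IsManifold I ∞ M] (X : VField I M) : Prop :=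
  ContMDiff I (I.prod 𝓘(ℝ, E)) ∞ (fun q ↦ TotalSpace.mk' E q (X q))

/-- The one-form `α` is smooth. -/
abbrev OneForm.Smooth [IsManifold I ∞ M] (α : OneForm I M) : Prop :=
  ContMDiff I (I.prod 𝓘(ℝ, E →L[ℝ] ℝ)) ∞ (fun q ↦ TotalSpace.mk' (E →L[ℝ] ℝ) q (α q))

/-- The two-covariant tensor field `T` is smooth. -/
abbrev TwoTensor.Smooth [IsManifold I ∞ M] (T : TwoTensor I M) : Prop :=
  ContMDiff I (I.prod 𝓘(ℝ, E →L[ℝ] E →L[ℝ] ℝ)) ∞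
    (fun q ↦ TotalSpace.mk' (E →L[ℝ] E →L[ℝ] ℝ) q (T q))

/-- Symmetrized tensor product `α ⊗ₛ β = (α ⊗ β + β ⊗ α) / 2` of one-forms. -/
def symProd (α β : OneForm I M) : TwoTensor I M := fun p ↦
  (1 / 2 : ℝ) • ((α p).smulRight (β p) + (β p).smulRight (α p))

/-- The differential `df` of a function. -/
def differential (f : M → ℝ) : OneForm I M := fun p ↦ mvfderiv I f p

open Classical in
/-- An operation `Φ` on pairs of vector fields which is tensorial at `p` (additive, and linear over
functions, in each of its arguments) defines a two-covariant tensor at `p`, with value `Φ X Y` on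
`X p`, `Y p`: see `tensorOf_apply`. For operations which are not tensorial at `p` the value is `0`.
-/
def tensorOf [FiniteDimensional ℝ E] [IsManifold I ∞ M]
    (Φ : VField I M → VField I M → ℝ) (p : M) :
    TangentSpace I p →L[ℝ] TangentSpace I p →L[ℝ] ℝ :=
  if h : (∀ Y : VField I M, Y.DiffAt p → TensorialAt I E (Φ · Y) p) ∧
      (∀ X : VField I M, X.DiffAt p → TensorialAt I E (Φ X) p) then
    have : ContMDiffVectorBundle 1 E (TangentSpace I : M → Type _) I :=
      .of_le (n := ∞) (by simp)
    TensorialAt.mkHom₂ (I := I) (F := E) (F' := E) Φ p h.1 h.2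
  else 0

theorem tensorOf_apply [FiniteDimensional ℝ E] [IsManifold I ∞ M]
    {Φ : VField I M → VField I M → ℝ} {p : M}
    (h₁ : ∀ Y : VField I M, Y.DiffAt p → TensorialAt I E (Φ · Y) p)
    (h₂ : ∀ X : VField I M, X.DiffAt p → TensorialAt I E (Φ X) p)
    {X Y : VField I M} (hX : X.DiffAt p) (hY : Y.DiffAt p) :
    tensorOf Φ p (X p) (Y p) = Φ X Y := by
  have : ContMDiffVectorBundle 1 E (TangentSpace I : M → Type _) I :=
    .of_le (n := ∞) (by simp)
  rw [tensorOf, dif_pos ⟨h₁, h₂⟩]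
  exact TensorialAt.mkHom₂_apply h₁ h₂ hX hY

/-- The Lie derivative of a two-covariant tensor field along the vector field `V`:
`(L_V T)(X, Y) = V (T(X, Y)) - T([V, X], Y) - T(X, [V, Y])`. -/
def lieDeriv [FiniteDimensional ℝ E] [IsManifold I ∞ M] (V : VField I M) (T : TwoTensor I M) :
    TwoTensor I M := fun p ↦
  tensorOf (fun X Y ↦ mvfderiv I (fun q ↦ T q (X q) (Y q)) p (V p)
    - T p (VectorField.mlieBracket I V X p) (Y p)
    - T p (X p) (VectorField.mlieBracket I V Y p)) p

/-- The exterior derivative of a one-form: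
`dα(X, Y) = X (α(Y)) - Y (α(X)) - α([X, Y])`. -/
def extD [FiniteDimensional ℝ E] [IsManifold I ∞ M] (α : OneForm I M) :
    TwoTensor I M := fun p ↦
  tensorOf (fun X Y ↦ mvfderiv I (fun q ↦ α q (Y q)) p (X p)
    - mvfderiv I (fun q ↦ α q (X q)) p (Y p)
    - α p (VectorField.mlieBracket I X Y p)) p

/-! ### Covariant derivatives of tensor fields and curvature -/

/-- `(∇_X α)(Y)` for a one-form `α`. -/
def covDeriv₁ (cov : VFieldOperator I M) (α : OneForm I M) (X Y : VField I M) (p : M) : ℝ :=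
  mvfderiv I (fun q ↦ α q (Y q)) p (X p) - α p (cov Y p (X p))

/-- `(∇_X T)(Y, Z)` for a two-covariant tensor field `T`. -/
def covDeriv₂ (cov : VFieldOperator I M) (T : TwoTensor I M) (X Y Z : VField I M) (p : M) : ℝ :=
  mvfderiv I (fun q ↦ T q (Y q) (Z q)) p (X p)
    - T p (cov Y p (X p)) (Z p) - T p (Y p) (cov Z p (X p))

/-- `(∇_X (T ⊗ α))(Y, Z, W)` for the three-covariant tensor field
`(T ⊗ α)(Y, Z, W) = T(Y, Z) α(W)`. -/
def covDerivProd (cov : VFieldOperator I M) (T : TwoTensor I M) (α : OneForm I M)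
    (X Y Z W : VField I M) (p : M) : ℝ :=
  mvfderiv I (fun q ↦ T q (Y q) (Z q) * α q (W q)) p (X p)
    - T p (cov Y p (X p)) (Z p) * α p (W p)
    - T p (Y p) (cov Z p (X p)) * α p (W p)
    - T p (Y p) (Z p) * α p (cov W p (X p))

/-- The curvature `R(X, Y) Z = ∇_X ∇_Y Z - ∇_Y ∇_X Z - ∇_{[X, Y]} Z`. In index notation
`R(e_c, e_d) e_b = R^a_{bcd} e_a`. -/
def curvature (cov : VFieldOperator I M) (X Y Z : VField I M) : VField I M := fun p ↦
  cov (fun q ↦ cov Z q (Y q)) p (X p) - cov (fun q ↦ cov Z q (X q)) p (Y p)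
    - cov Z p (VectorField.mlieBracket I X Y p)

/-! ### Hypersurface data -/

variable (I M) in
/-- The tensors `γ`, `ℓ`, `ℓ⁽²⁾`, `Y` on `M` underlying hypersurface data, without the conditions
they have to satisfy; for these see `IsHypersurfaceData`. -/
@[ext]
structure Tuple where
  /-- the two-covariant tensor `γ` -/
  γ : TwoTensor I M
  /-- the one-form `ℓ` -/
  l : OneForm I M
  /-- the scalar `ℓ⁽²⁾` -/
  l2 : M → ℝ
  /-- the two-covariant tensor `Y` -/
  Y : TwoTensor I M

namespace Tuple

/-- The two-covariant tensor on `T_p M × ℝ`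
`𝒜((W, a), (Z, b)) = γ(W, Z) + a ℓ(Z) + b ℓ(W) + a b ℓ⁽²⁾`. -/
def ambient (D : Tuple I M) (p : M) :
    (TangentSpace I p × ℝ) →L[ℝ] (TangentSpace I p × ℝ) →L[ℝ] ℝ :=
  let π₁ := ContinuousLinearMap.fst ℝ (TangentSpace I p) ℝ
  let π₂ := ContinuousLinearMap.snd ℝ (TangentSpace I p) ℝ
  (ContinuousLinearMap.precomp ℝ π₁).comp ((D.γ p).comp π₁)
    + π₂.smulRight ((D.l p).comp π₁) + ((D.l p).comp π₁).smulRight π₂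
    + D.l2 p • π₂.smulRight π₂

theorem ambient_apply (D : Tuple I M) (p : M) (W Z : TangentSpace I p) (a b : ℝ) :
    D.ambient p (W, a) (Z, b) = D.γ p W Z + a * D.l p Z + b * D.l p W + a * b * D.l2 p := by
  simp [ambient]
  ring

/-- Hypersurface data: `γ`, `Y` are smooth symmetric two-covariant tensors, `ℓ` is a smooth one-form
and `ℓ⁽²⁾` a smooth function, such that `𝒜` is non-degenerate at every point. -/
structure IsHypersurfaceData [IsManifold I ∞ M] (D : Tuple I M) : Prop where
  smooth_γ : TwoTensor.Smooth D.γ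
  symm_γ : ∀ (p : M) (v w : TangentSpace I p), D.γ p v w = D.γ p w v
  smooth_l : OneForm.Smooth D.l
  smooth_l2 : ContMDiff I 𝓘(ℝ, ℝ) ∞ D.l2
  smooth_Y : TwoTensor.Smooth D.Y
  symm_Y : ∀ (p : M) (v w : TangentSpace I p), D.Y p v w = D.Y p w v
  nondegenerate : ∀ (p : M) (V : TangentSpace I p × ℝ), (∀ W, D.ambient p V W = 0) → V = 0

/-- The pair `(n, n⁽²⁾) = 𝒜♯((0, 1), ·)` at `p`, that is, the vector `V` of `T_p M × ℝ` such that
`𝒜(V, (Z, b)) = b` for all `(Z, b)`. -/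
def nPair (D : Tuple I M) (p : M) : TangentSpace I p × ℝ :=
  (D.ambient p).inverse (ContinuousLinearMap.snd ℝ (TangentSpace I p) ℝ)

/-- The vector field `n`. -/
def n (D : Tuple I M) : VField I M := fun p ↦ (D.nPair p).1

/-- The scalar `n⁽²⁾`. -/
def n2 (D : Tuple I M) : M → ℝ := fun p ↦ (D.nPair p).2

/-- Null hypersurface data: hypersurface data with `n⁽²⁾ = 0` everywhere. -/
structure IsNullHypersurfaceData [IsManifold I ∞ M] (D : Tuple I M) : Prop
    extends IsHypersurfaceData D where
  null : ∀ p, D.n2 p = 0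

variable [FiniteDimensional ℝ E] [IsManifold I ∞ M]

/-- The tensor `K = n⁽²⁾ Y + (1/2) L_n γ + ℓ ⊗ₛ dn⁽²⁾`. -/
def K (D : Tuple I M) : TwoTensor I M := fun p ↦
  D.n2 p • D.Y p + (1 / 2 : ℝ) • lieDeriv D.n D.γ p + symProd D.l (differential D.n2) p

/-- The two-form `F = (1/2) dℓ`. -/
def F (D : Tuple I M) : TwoTensor I M := fun p ↦ (1 / 2 : ℝ) • extD D.l p

/-- The conditions that define the connection `∇` of the data: it is a torsion-free covariant
derivative with
`(∇_X γ)(Z, W) = - ℓ(Z) K(X, W) - ℓ(W) K(X, Z)` and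
`(∇_X ℓ)(Z) = Y(X, Z) + F(X, Z) - ℓ⁽²⁾ K(X, Z)`. -/
structure IsConnection (D : Tuple I M) (cov : VFieldOperator I M) : Prop where
  isCovariantDerivative : IsCovariantDerivativeOn E cov
  torsion_free : ∀ (p : M) (X Z : VField I M), X.DiffAt p → Z.DiffAt p →
    cov Z p (X p) - cov X p (Z p) = VectorField.mlieBracket I X Z p
  covDeriv_γ : ∀ (p : M) (X Z W : VField I M), X.DiffAt p → Z.DiffAt p → W.DiffAt p →
    covDeriv₂ cov D.γ X Z W p =
      - D.l p (Z p) * D.K p (X p) (W p) - D.l p (W p) * D.K p (X p) (Z p)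
  covDeriv_l : ∀ (p : M) (X Z : VField I M), X.DiffAt p → Z.DiffAt p →
    covDeriv₁ cov D.l X Z p =
      D.Y p (X p) (Z p) + D.F p (X p) (Z p) - D.l2 p * D.K p (X p) (Z p)

/-- The connection `∇` of the data: the covariant derivative defined by the conditions
`IsConnection`. (These determine it on differentiable vector fields; the values of a covariant
derivative on fields which are not differentiable are irrelevant.) -/
def connection (D : Tuple I M) : VFieldOperator I M :=
  Classical.epsilon fun cov ↦ D.IsConnection cov

/-- The gauge transformed data `𝒢_{(z, ζ)} D`. -/
def gauge (z : M → ℝ) (ζ : VField I M) (D : Tuple I M) : Tuple I M where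
  γ := D.γ
  l := fun p ↦ z p • (D.l p + D.γ p (ζ p))
  l2 := fun p ↦ z p ^ 2 * (D.l2 p + 2 * D.l p (ζ p) + D.γ p (ζ p) (ζ p))
  Y := fun p ↦ z p • D.Y p + symProd D.l (differential z) p
    + (1 / 2 : ℝ) • lieDeriv (fun q ↦ z q • ζ q) D.γ p

/-- The tensor `A_{bcd} = ℓ_a R^a_{bcd} + 2 ℓ⁽²⁾ ∇_{[d} K_{c]b} + K_{b[c} ∇_{d]} ℓ⁽²⁾`, evaluated on
vector fields `X, Y, Z` in the slots `b, c, d`. -/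
def A (D : Tuple I M) (X Y Z : VField I M) (p : M) : ℝ :=
  D.l p (curvature D.connection Y Z X p)
    + D.l2 p * (covDeriv₂ D.connection D.K Z Y X p - covDeriv₂ D.connection D.K Y Z X p)
    + (1 / 2) * (D.K p (X p) (Y p) * mvfderiv I D.l2 p (Z p)
      - D.K p (X p) (Z p) * mvfderiv I D.l2 p (Y p))

/-- The tensor
`B_{abcd} = γ_{af} R^f_{bcd} + 2 ∇_{[d} (K_{c]b} ℓ_a) + 2 ℓ⁽²⁾ K_{b[c} K_{d]a}`, evaluated on vector
fields `W, X, Y, Z` in the slots `a, b, c, d`. -/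
def B (D : Tuple I M) (W X Y Z : VField I M) (p : M) : ℝ :=
  D.γ p (W p) (curvature D.connection Y Z X p)
    + (covDerivProd D.connection D.K D.l Z Y X W p - covDerivProd D.connection D.K D.l Y Z X W p)
    + D.l2 p * (D.K p (X p) (Y p) * D.K p (Z p) (W p) - D.K p (X p) (Z p) * D.K p (Y p) (W p))

end Tuple

end HypersurfaceData

end

open scoped Topology

noncomputable section

namespace HypersurfaceData

variable {E : Type*} [NormedAddCommGroup E] [NormedSpace ℝ E]
  {H : Type*} [TopologicalSpace H] {I : ModelWithCorners ℝ E H}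
  {M : Type*} [TopologicalSpace M] [ChartedSpace H M]

/-! ### Smoothness of contractions -/

section Smoothness

variable [IsManifold I ∞ M]

/-! Everything follows from how three objects change under the gauge. The form `𝒜'` is the pullback
of `𝒜` by `(v, a) ↦ (v + a z ζ, z a)`, so `n' = z⁻¹ n` and `n⁽²⁾' = 0`. Since `γ(n, ·) = 0`, the
field `n` may be rescaled inside `L_n γ`, whence `K' = z⁻¹ K` (`gauge_K`). Finally `∇' = ∇ + K ⊗ ζ`:
the right-hand side satisfies the conditions defining the connection of the new data
(`isConnection_shift`), and those conditions have a unique solution (`IsConnection.eq_of_diffAt`).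

The curvature of `∇ + K ⊗ ζ` (`gauge_curvature`) differs from that of `∇` by terms in `∇ζ`, in the
antisymmetrized `∇K`, and quadratic in `K`. The corrections in `A` and `B` change by the opposite
amounts, up to the stated factor `z` and the mixing `i_ζ B`; `gauge_B` and `gauge_A` are this
algebra.

Two analytic points lie underneath. `connection` is an epsilon choice, so a connection has to be
produced: a Koszul formula prescribes `γ(∇_X Z, ·)`, the equation for `∇ℓ` prescribes `ℓ(∇_X Z)`,
and the two are compatible because `γ(n, ·) = 0` and `ℓ(n) = 1`. The curvature differentiates `∇_X
Z`, so this field must be regular: it is determined by its pairings with `γ` and `ℓ`, and Cramer's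
rule carries their smoothness over to it (`contAt_of_pairing`). -/

/-- The vector field `X` is of class `C^m` at `p`. -/
abbrev VField.ContAt (m : ℕ∞) (X : VField I M) (p : M) : Prop :=
  ContMDiffAt I (I.prod 𝓘(ℝ, E)) m (fun q ↦ TotalSpace.mk' E q (X q)) p

theorem OneForm.Smooth.contMDiffAt_apply {α : OneForm I M} (hα : α.Smooth) {m : ℕ∞}
    {X : VField I M} {p : M} (hX : X.ContAt m p) :
    ContMDiffAt I 𝓘(ℝ, ℝ) m (fun q ↦ α q (X q)) p := by
  have h := ContMDiffAt.clm_bundle_apply (F₁ := E) (F₂ := ℝ) (E₁ := (TangentSpace I : M → Type _))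
    (E₂ := Bundle.Trivial M ℝ) (b := fun q : M ↦ q) (ϕ := α)
    ((hα p).of_le (by exact_mod_cast le_top)) hX
  exact (contMDiffAt_totalSpace.1 h).2

theorem TwoTensor.Smooth.contMDiffAt_apply {T : TwoTensor I M} (hT : T.Smooth) {m : ℕ∞}
    {X Y : VField I M} {p : M} (hX : X.ContAt m p) (hY : Y.ContAt m p) :
    ContMDiffAt I 𝓘(ℝ, ℝ) m (fun q ↦ T q (X q) (Y q)) p := by
  have h := ContMDiffAt.clm_bundle_apply₂ (F₁ := E) (F₂ := E) (F₃ := ℝ)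
    (E₁ := (TangentSpace I : M → Type _)) (E₂ := (TangentSpace I : M → Type _))
    (E₃ := Bundle.Trivial M ℝ) (b := fun q : M ↦ q) (ψ := T)
    ((hT p).of_le (by exact_mod_cast le_top)) hX hY
  exact (contMDiffAt_totalSpace.1 h).2

theorem OneForm.Smooth.mdifferentiableAt_apply {α : OneForm I M} (hα : α.Smooth)
    {X : VField I M} {p : M} (hX : X.DiffAt p) :
    MDifferentiableAt I 𝓘(ℝ, ℝ) (fun q ↦ α q (X q)) p := by
  have h := MDifferentiableAt.clm_bundle_apply (F₁ := E) (F₂ := ℝ)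
    (E₁ := (TangentSpace I : M → Type _))
    (E₂ := Bundle.Trivial M ℝ) (b := fun q : M ↦ q) (ϕ := α)
    ((hα p).mdifferentiableAt (by simp)) hX
  exact ((mdifferentiableAt_totalSpace _ _).1 h).2

theorem TwoTensor.Smooth.mdifferentiableAt_apply {T : TwoTensor I M} (hT : T.Smooth)
    {X Y : VField I M} {p : M} (hX : X.DiffAt p) (hY : Y.DiffAt p) :
    MDifferentiableAt I 𝓘(ℝ, ℝ) (fun q ↦ T q (X q) (Y q)) p := by
  have h := MDifferentiableAt.clm_bundle_apply₂ (F₁ := E) (F₂ := E) (F₃ := ℝ)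
    (E₁ := (TangentSpace I : M → Type _)) (E₂ := (TangentSpace I : M → Type _))
    (E₃ := Bundle.Trivial M ℝ) (b := fun q : M ↦ q) (ψ := T)
    ((hT p).mdifferentiableAt (by simp)) hX hY
  exact ((mdifferentiableAt_totalSpace _ _).1 h).2

theorem contMDiffAt_mvfderiv_apply {f : M → ℝ} {V : VField I M} {p : M} {m : ℕ∞}
    (hf : ContMDiffAt I 𝓘(ℝ, ℝ) (m + 1) f p) (hV : V.ContAt m p) :
    ContMDiffAt I 𝓘(ℝ, ℝ) m (fun q ↦ mvfderiv I f q (V q)) p := by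
  have h1 := hf.mfderiv_const (m := m) le_rfl
  have h := ContMDiffAt.clm_apply_of_inCoordinates (F₁ := E) (F₂ := ℝ)
    (E₁ := (TangentSpace I : M → Type _)) (E₂ := (TangentSpace 𝓘(ℝ, ℝ) : ℝ → Type _))
    (b₁ := id) (b₂ := f) (ϕ := mfderiv I 𝓘(ℝ, ℝ) f) (v := V) h1 hV (hf.of_le (by simp))
  rw [contMDiffAt_totalSpace] at h
  simpa using! h.2

theorem VField.ContAt.mlieBracket [CompleteSpace E] {X Y : VField I M} {p : M} {m : ℕ∞}
    (hX : X.ContAt (m + 1) p) (hY : Y.ContAt (m + 1) p) :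
    VField.ContAt m (VectorField.mlieBracket I X Y) p := by
  have : IsManifold I ((m + 1 : ℕ∞) + 1) M := .of_le (n := ∞) (by exact_mod_cast le_top)
  have : IsManifold I (minSmoothness ℝ 2) M := by
    rw [minSmoothness_of_isRCLikeNormedField]; infer_instance
  have : IsManifold I (minSmoothness ℝ 3) M := by
    rw [minSmoothness_of_isRCLikeNormedField]; infer_instance
  exact ContMDiffAt.mlieBracket_vectorField (n := m + 1) hX hY (by simp)

theorem VField.ContAt.diffAt {X : VField I M} {p : M} {m : ℕ∞} (hm : m ≠ 0)
    (hX : X.ContAt m p) : X.DiffAt p :=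
  hX.mdifferentiableAt (by exact_mod_cast hm)

theorem VField.ContAt.of_succ {m : ℕ∞} {X : VField I M} {p : M}
    (hX : X.ContAt (m + 1) p) : X.ContAt m p :=
  ContMDiffAt.of_le hX (by simp)

theorem VField.ContAt.one_of_succ {m : ℕ∞} {X : VField I M} {p : M}
    (hX : X.ContAt (m + 1) p) : X.ContAt 1 p :=
  ContMDiffAt.of_le hX (by exact_mod_cast le_add_self)

theorem VField.ContAt.eventually_diffAt {X : VField I M} {p : M}
    (hX : X.ContAt 1 p) : ∀ᶠ q in 𝓝 p, X.DiffAt q := by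
  filter_upwards [(contMDiffAt_iff_contMDiffAt_nhds (by simp)).1 hX] with q hq
  exact ContMDiffAt.mdifferentiableAt hq (by simp)

theorem VField.SmoothAt.contAt {X : VField I M} {p : M} (hX : X.SmoothAt p) (m : ℕ∞) :
    X.ContAt m p :=
  hX.of_le (by exact_mod_cast le_top)

theorem VField.SmoothAt.diffAt {X : VField I M} {p : M} (hX : X.SmoothAt p) : X.DiffAt p :=
  hX.mdifferentiableAt (by simp)

/-- Every tangent vector is the value of a vector field which is smooth near its base point. -/
theorem exists_smoothAt_eq [FiniteDimensional ℝ E] (p : M) (v : TangentSpace I p) :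
    ∃ X : VField I M, X.SmoothAt p ∧ X p = v :=
  ⟨FiberBundle.extend E v, FiberBundle.contMDiffAt_extend I E v, by simp⟩

end Smoothness

/-! ### Linear systems with smooth coefficients -/

section Cramer

variable {κ : Type*} [Fintype κ] [DecidableEq κ]

theorem contMDiffAt_det {m : ℕ∞} {p : M} {G : M → Matrix κ κ ℝ}
    (hG : ∀ i j, ContMDiffAt I 𝓘(ℝ, ℝ) m (fun q ↦ G q i j) p) :
    ContMDiffAt I 𝓘(ℝ, ℝ) m (fun q ↦ (G q).det) p := by
  simp only [Matrix.det_apply]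
  refine ContMDiffAt.sum fun σ _ ↦ ?_
  have h : ContMDiffAt I 𝓘(ℝ, ℝ) m (fun q ↦ ∏ i, G q (σ i) i) p :=
    ContMDiffAt.prod fun i _ ↦ hG _ _
  simpa only [Units.smul_def, zsmul_eq_mul] using!
    (contMDiffAt_const (c := ((σ.sign : ℤ) : ℝ))).mul h

/-- Cramer's rule: near `p` the determinant stays nonzero and `x q i` is a quotient of determinants.
No continuity of `x` is assumed; it comes out of the formula. -/
theorem contMDiffAt_of_mulVec {m : ℕ∞} {p : M} {G : M → Matrix κ κ ℝ} {x b : M → κ → ℝ}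
    (hG : ∀ i j, ContMDiffAt I 𝓘(ℝ, ℝ) m (fun q ↦ G q i j) p)
    (hdet : (G p).det ≠ 0)
    (hb : ∀ i, ContMDiffAt I 𝓘(ℝ, ℝ) m (fun q ↦ b q i) p)
    (hx : ∀ᶠ q in 𝓝 p, (G q).mulVec (x q) = b q) (i : κ) :
    ContMDiffAt I 𝓘(ℝ, ℝ) m (fun q ↦ x q i) p := by
  have hd := contMDiffAt_det hG
  have hne : ∀ᶠ q in 𝓝 p, (G q).det ≠ 0 := hd.continuousAt.eventually_ne hdet
  have h : ContMDiffAt I 𝓘(ℝ, ℝ) m (fun q ↦ (G q).det⁻¹ * ((G q).updateCol i (b q)).det) p := by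
    refine (hd.inv₀ hdet).mul (contMDiffAt_det fun j k ↦ ?_)
    by_cases hk : k = i
    · subst hk; simpa using hb j
    · simpa [Matrix.updateCol_apply, hk] using hG j k
  refine h.congr_of_eventuallyEq ?_
  filter_upwards [hne, hx] with q hq hxq
  rw [← Matrix.cramer_apply, ← hxq, Matrix.cramer_eq_adjugate_mulVec, Matrix.mulVec_mulVec,
    Matrix.adjugate_mul, Matrix.smul_mulVec, Matrix.one_mulVec, Pi.smul_apply, smul_eq_mul,
    inv_mul_cancel_left₀ hq]

end Cramer

/-! ### Vector fields determined by their pairings -/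

section Pairing

variable [FiniteDimensional ℝ E] [IsManifold I ∞ M]

/-- For hypersurface data, a vector field `U` and a function `a` such that the pairings of `(U, a)`
with `(W, 0)` and `(0, 1)` are of class `C^m` are themselves of class `C^m`. -/
theorem Tuple.IsHypersurfaceData.contAt_of_pairing {D : Tuple I M} (hD : D.IsHypersurfaceData)
    {m : ℕ∞} {p : M} {U : VField I M} {a : M → ℝ}
    (h₁ : ∀ W : VField I M, W.SmoothAt p →
      ContMDiffAt I 𝓘(ℝ, ℝ) m (fun q ↦ D.γ q (U q) (W q) + a q * D.l q (W q)) p)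
    (h₂ : ContMDiffAt I 𝓘(ℝ, ℝ) m (fun q ↦ D.l q (U q) + a q * D.l2 q) p) :
    U.ContAt m p := by
  classical
  have : ContMDiffVectorBundle 1 E (TangentSpace I : M → Type _) I :=
    .of_le (n := ∞) (by simp)
  let t := trivializationAt E (TangentSpace I : M → Type _) p
  have hpt : p ∈ t.baseSet := FiberBundle.mem_baseSet_trivializationAt E _ p
  let b := Module.finBasis ℝ E
  let e : Fin (Module.finrank ℝ E) → VField I M := t.localFrame b
  let c : Fin (Module.finrank ℝ E) → M → ℝ := fun i q ↦ t.localFrameCoeff I b i q (U q)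
  have he : ∀ i, VField.SmoothAt (e i) p := fun i ↦ contMDiffAt_localFrame_of_mem ∞ _ b i hpt
  have hm : ∀ i, VField.ContAt m (e i) p := fun i ↦ (he i).contAt m
  have hU : ∀ q ∈ t.baseSet, U q = ∑ i, c i q • e i q := fun q hq ↦
    t.eq_sum_localFrameCoeff_smul hq
  -- The Gram matrix of `𝒜` in the basis `(e i, 0)`, `(0, 1)`; the index `none` stands for `(0, 1)`.
  let G : M → Matrix (Option (Fin (Module.finrank ℝ E))) (Option (Fin (Module.finrank ℝ E))) ℝ :=
    fun q ↦ Matrix.of fun j i ↦ match j, i with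
      | some j, some i => D.γ q (e i q) (e j q)
      | some j, none => D.l q (e j q)
      | none, some i => D.l q (e i q)
      | none, none => D.l2 q
  let β : M → Option (Fin (Module.finrank ℝ E)) → ℝ := fun q j ↦ match j with
      | some j => D.γ q (U q) (e j q) + a q * D.l q (e j q)
      | none => D.l q (U q) + a q * D.l2 q
  let x : M → Option (Fin (Module.finrank ℝ E)) → ℝ := fun q j ↦ match j with
      | some j => c j q
      | none => a q
  have hG : ∀ j i, ContMDiffAt I 𝓘(ℝ, ℝ) m (fun q ↦ G q j i) p := by
    rintro (_ | j) (_ | i)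
    · exact (hD.smooth_l2 p).of_le (by exact_mod_cast le_top)
    · exact hD.smooth_l.contMDiffAt_apply (hm i)
    · exact hD.smooth_l.contMDiffAt_apply (hm j)
    · exact hD.smooth_γ.contMDiffAt_apply (hm i) (hm j)
  have hβ : ∀ j, ContMDiffAt I 𝓘(ℝ, ℝ) m (fun q ↦ β q j) p := by
    rintro (_ | j)
    · exact h₂
    · exact h₁ _ (he j)
  have hx : ∀ᶠ q in 𝓝 p, (G q).mulVec (x q) = β q := by
    filter_upwards [t.open_baseSet.mem_nhds hpt] with q hq
    ext (_ | j)
    · simp only [Matrix.mulVec, dotProduct, Fintype.sum_option, G, x, β, Matrix.of_apply, hU q hq,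
        map_sum, map_smul, smul_eq_mul]
      rw [add_comm, mul_comm]
      simp only [mul_comm]
    · simp only [Matrix.mulVec, dotProduct, Fintype.sum_option, G, x, β, Matrix.of_apply, hU q hq,
        map_sum, map_smul, smul_eq_mul, sum_apply,
        smul_apply]
      rw [add_comm, mul_comm]
      simp only [mul_comm]
  -- A null vector of the Gram matrix would be a nonzero vector in the radical of `𝒜`.
  have hdet : (G p).det ≠ 0 := by
    intro h0
    obtain ⟨v, hv0, hv⟩ := Matrix.exists_mulVec_eq_zero_iff.2 h0
    apply hv0
    let V : TangentSpace I p := ∑ i, v (some i) • e i p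
    have key : (V, v none) = (0 : TangentSpace I p × ℝ) := by
      apply hD.nondegenerate p
      rintro ⟨W, s⟩
      rw [Tuple.ambient_apply]
      have hW : W = ∑ i, (t.basisAt b hpt).repr W i • e i p := by
        conv_lhs => rw [← (t.basisAt b hpt).sum_repr W]
        simp [e, hpt]
      have hj : ∀ j, D.γ p V (e j p) + v none * D.l p (e j p) = 0 := by
        intro j
        have := congrFun hv (some j)
        simp only [Matrix.mulVec, dotProduct, Fintype.sum_option, G, Matrix.of_apply,
          Pi.zero_apply] at this
        rw [← this]
        simp only [V, map_sum, map_smul, smul_eq_mul, sum_apply,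
          smul_apply]
        rw [add_comm, mul_comm]
        simp only [mul_comm]
      have hn : D.l p V + v none * D.l2 p = 0 := by
        have := congrFun hv none
        simp only [Matrix.mulVec, dotProduct, Fintype.sum_option, G, Matrix.of_apply,
          Pi.zero_apply] at this
        rw [← this]
        simp only [V, map_sum, map_smul, smul_eq_mul]
        rw [add_comm, mul_comm]
        simp only [mul_comm]
      have hWs : D.γ p V W + v none * D.l p W = 0 := by
        rw [hW]
        simp only [map_sum, map_smul, smul_eq_mul]
        rw [Finset.mul_sum, ← Finset.sum_add_distrib]
        refine Finset.sum_eq_zero fun i _ ↦ ?_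
        linear_combination ((t.basisAt b hpt).repr W i) * hj i
      linear_combination hWs + s * hn
    rw [Prod.mk_eq_zero] at key
    have hV := key.1
    have : V = ∑ i, v (some i) • t.basisAt b hpt i := by simp [V, e, hpt]
    rw [this] at hV
    have hli := (Fintype.linearIndependent_iff.1 (t.basisAt b hpt).linearIndependent) _ hV
    ext (_ | j)
    · exact key.2
    · exact hli j
  have hc : ∀ i, ContMDiffAt I 𝓘(ℝ, ℝ) m (c i) p := fun i ↦
    contMDiffAt_of_mulVec hG hdet hβ hx (some i)
  have hsum : VField.ContAt m (fun q ↦ ∑ i, c i q • e i q : VField I M) p :=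
    ContMDiffAt.sum_section fun i _ ↦ (hc i).smul_section (hm i)
  refine ContMDiffAt.congr_of_eventuallyEq hsum ?_
  filter_upwards [t.open_baseSet.mem_nhds hpt] with q hq
  rw [hU q hq]

end Pairing

/-! ### Lie derivative and exterior derivative on differentiable fields -/

section Derivatives

section

variable {f g : M → ℝ} {p : M} {v : TangentSpace I p}

theorem mvfderiv_mul_apply (hf : MDifferentiableAt I 𝓘(ℝ, ℝ) f p)
    (hg : MDifferentiableAt I 𝓘(ℝ, ℝ) g p) :
    mvfderiv I (fun q ↦ f q * g q) p v = f p * mvfderiv I g p v + g p * mvfderiv I f p v := by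
  rw [mvfderiv_fun_mul hf hg]; simp

theorem mvfderiv_add_apply (hf : MDifferentiableAt I 𝓘(ℝ, ℝ) f p)
    (hg : MDifferentiableAt I 𝓘(ℝ, ℝ) g p) :
    mvfderiv I (fun q ↦ f q + g q) p v = mvfderiv I f p v + mvfderiv I g p v := by
  rw [mvfderiv_fun_add hf hg]; simp

end

variable [IsManifold I ∞ M]

theorem VField.DiffAt.add {X Y : VField I M} {p : M} (hX : X.DiffAt p) (hY : Y.DiffAt p) :
    VField.DiffAt (X + Y) p :=
  mdifferentiableAt_add_section hX hY

theorem VField.DiffAt.smul {f : M → ℝ} {X : VField I M} {p : M}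
    (hf : MDifferentiableAt I 𝓘(ℝ, ℝ) f p) (hX : X.DiffAt p) : VField.DiffAt (f • X) p :=
  hf.smul_section hX

/-- The pairing of `α` with vector fields differentiable at `p` is differentiable at `p`. -/
def OneForm.DiffAt (α : OneForm I M) (p : M) : Prop :=
  ∀ X : VField I M, X.DiffAt p → MDifferentiableAt I 𝓘(ℝ, ℝ) (fun q ↦ α q (X q)) p

/-- The pairing of `T` with vector fields differentiable at `p` is differentiable at `p`. -/
def TwoTensor.DiffAt (T : TwoTensor I M) (p : M) : Prop :=
  ∀ X Y : VField I M, X.DiffAt p → Y.DiffAt p →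
    MDifferentiableAt I 𝓘(ℝ, ℝ) (fun q ↦ T q (X q) (Y q)) p

theorem OneForm.Smooth.diffAt {α : OneForm I M} (hα : α.Smooth) (p : M) : α.DiffAt p :=
  fun _ hX ↦ hα.mdifferentiableAt_apply hX

theorem TwoTensor.Smooth.diffAt {T : TwoTensor I M} (hT : T.Smooth) (p : M) : T.DiffAt p :=
  fun _ _ hX hY ↦ hT.mdifferentiableAt_apply hX hY

section Rules

variable {α : OneForm I M} {T : TwoTensor I M} {X Y Z : VField I M} {f g : M → ℝ} {p : M}
  {v : TangentSpace I p}

theorem OneForm.DiffAt.mvfderiv_smul (hα : α.DiffAt p) (hf : MDifferentiableAt I 𝓘(ℝ, ℝ) f p)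
    (hX : X.DiffAt p) :
    mvfderiv I (fun q ↦ α q ((f • X) q)) p v =
      f p * mvfderiv I (fun q ↦ α q (X q)) p v + α p (X p) * mvfderiv I f p v := by
  rw [← mvfderiv_mul_apply hf (hα X hX)]
  simp

theorem OneForm.DiffAt.mvfderiv_add (hα : α.DiffAt p) (hX : X.DiffAt p) (hY : Y.DiffAt p) :
    mvfderiv I (fun q ↦ α q ((X + Y) q)) p v =
      mvfderiv I (fun q ↦ α q (X q)) p v + mvfderiv I (fun q ↦ α q (Y q)) p v := by
  rw [← mvfderiv_add_apply (hα X hX) (hα Y hY)]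
  simp

theorem TwoTensor.DiffAt.mvfderiv_smul_left (hT : T.DiffAt p)
    (hf : MDifferentiableAt I 𝓘(ℝ, ℝ) f p) (hX : X.DiffAt p) (hY : Y.DiffAt p) :
    mvfderiv I (fun q ↦ T q ((f • X) q) (Y q)) p v =
      f p * mvfderiv I (fun q ↦ T q (X q) (Y q)) p v + T p (X p) (Y p) * mvfderiv I f p v := by
  rw [← mvfderiv_mul_apply hf (hT X Y hX hY)]
  simp

theorem TwoTensor.DiffAt.mvfderiv_smul_right (hT : T.DiffAt p)
    (hf : MDifferentiableAt I 𝓘(ℝ, ℝ) f p) (hX : X.DiffAt p) (hY : Y.DiffAt p) :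
    mvfderiv I (fun q ↦ T q (X q) ((f • Y) q)) p v =
      f p * mvfderiv I (fun q ↦ T q (X q) (Y q)) p v + T p (X p) (Y p) * mvfderiv I f p v := by
  rw [← mvfderiv_mul_apply hf (hT X Y hX hY)]
  simp

theorem TwoTensor.DiffAt.mvfderiv_add_left (hT : T.DiffAt p)
    (hX : X.DiffAt p) (hZ : Z.DiffAt p) (hY : Y.DiffAt p) :
    mvfderiv I (fun q ↦ T q ((X + Z) q) (Y q)) p v =
      mvfderiv I (fun q ↦ T q (X q) (Y q)) p v + mvfderiv I (fun q ↦ T q (Z q) (Y q)) p v := by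
  rw [← mvfderiv_add_apply (hT X Y hX hY) (hT Z Y hZ hY)]
  simp

theorem TwoTensor.DiffAt.mvfderiv_add_right (hT : T.DiffAt p)
    (hX : X.DiffAt p) (hY : Y.DiffAt p) (hZ : Z.DiffAt p) :
    mvfderiv I (fun q ↦ T q (X q) ((Y + Z) q)) p v =
      mvfderiv I (fun q ↦ T q (X q) (Y q)) p v + mvfderiv I (fun q ↦ T q (X q) (Z q)) p v := by
  rw [← mvfderiv_add_apply (hT X Y hX hY) (hT X Z hX hZ)]
  simp

end Rules

variable [FiniteDimensional ℝ E]

/-- The terms containing the derivative of `f` along `V`, one from the function and one from the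
bracket, cancel, so the expression is tensorial and `tensorOf` is not in its default branch. Nothing
is asked of `V`: the rules for the right argument of the bracket concern that argument alone. -/
theorem lieDeriv_apply {V : VField I M} {T : TwoTensor I M} {p : M} (hT : T.DiffAt p)
    {X Y : VField I M} (hX : X.DiffAt p) (hY : Y.DiffAt p) :
    lieDeriv V T p (X p) (Y p) = mvfderiv I (fun q ↦ T q (X q) (Y q)) p (V p)
      - T p (VectorField.mlieBracket I V X p) (Y p)
      - T p (X p) (VectorField.mlieBracket I V Y p) := by
  have : CompleteSpace E := FiniteDimensional.complete ℝ E
  refine tensorOf_apply (Φ := fun X Y ↦ mvfderiv I (fun q ↦ T q (X q) (Y q)) p (V p)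
    - T p (VectorField.mlieBracket I V X p) (Y p)
    - T p (X p) (VectorField.mlieBracket I V Y p)) (fun Z hZ ↦ ⟨?_, ?_⟩) (fun Z hZ ↦ ⟨?_, ?_⟩) hX hY
  · intro f σ hf hσ
    rw [hT.mvfderiv_smul_left hf hσ hZ, VectorField.mlieBracket_smul_right hf hσ]
    simp
    ring
  · intro σ σ' hσ hσ'
    rw [hT.mvfderiv_add_left hσ hσ' hZ, VectorField.mlieBracket_add_right hσ hσ']
    simp
    ring
  · intro f σ hf hσ
    rw [hT.mvfderiv_smul_right hf hZ hσ, VectorField.mlieBracket_smul_right hf hσ]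
    simp
    ring
  · intro σ σ' hσ hσ'
    rw [hT.mvfderiv_add_right hZ hσ hσ', VectorField.mlieBracket_add_right hσ hσ']
    simp
    ring

theorem extD_apply {α : OneForm I M} {p : M} (hα : α.DiffAt p)
    {X Y : VField I M} (hX : X.DiffAt p) (hY : Y.DiffAt p) :
    extD α p (X p) (Y p) = mvfderiv I (fun q ↦ α q (Y q)) p (X p)
      - mvfderiv I (fun q ↦ α q (X q)) p (Y p)
      - α p (VectorField.mlieBracket I X Y p) := by
  have : CompleteSpace E := FiniteDimensional.complete ℝ E
  refine tensorOf_apply (Φ := fun X Y ↦ mvfderiv I (fun q ↦ α q (Y q)) p (X p)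
    - mvfderiv I (fun q ↦ α q (X q)) p (Y p)
    - α p (VectorField.mlieBracket I X Y p)) (fun Z hZ ↦ ⟨?_, ?_⟩) (fun Z hZ ↦ ⟨?_, ?_⟩) hX hY
  · intro f σ hf hσ
    rw [hα.mvfderiv_smul hf hσ, VectorField.mlieBracket_smul_left hf hσ]
    simp
    ring
  · intro σ σ' hσ hσ'
    rw [hα.mvfderiv_add hσ hσ', VectorField.mlieBracket_add_left hσ hσ']
    simp
    ring
  · intro f σ hf hσ
    rw [hα.mvfderiv_smul hf hσ, VectorField.mlieBracket_smul_right hf hσ]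
    simp
    ring
  · intro σ σ' hσ hσ'
    rw [hα.mvfderiv_add hσ hσ', VectorField.mlieBracket_add_right hσ hσ']
    simp
    ring

end Derivatives

/-! ### The vector field `n` -/

section Normal

namespace Tuple.IsNullHypersurfaceData

variable [IsManifold I ∞ M] {D : Tuple I M}

theorem eq_zero_of_pairing (hD : D.IsNullHypersurfaceData) {p : M} {v : TangentSpace I p}
    (h₁ : ∀ w, D.γ p v w = 0) (h₂ : D.l p v = 0) : v = 0 := by
  have := hD.nondegenerate p (v, 0) (fun ⟨w, b⟩ ↦ by simp [ambient_apply, h₁, h₂])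
  exact (Prod.mk_eq_zero.1 this).1

theorem eq_of_pairing (hD : D.IsNullHypersurfaceData) {p : M} {u v : TangentSpace I p}
    (h₁ : ∀ w, D.γ p u w = D.γ p v w) (h₂ : D.l p u = D.l p v) : u = v :=
  sub_eq_zero.1 (hD.eq_zero_of_pairing (by simp [h₁]) (by simp [h₂]))

end Tuple.IsNullHypersurfaceData

/-- An injective map between `V` and its dual is bijective by equality of dimensions. This gives
`nPair` its meaning, as `ContinuousLinearMap.inverse` is zero on non-invertible maps. -/
theorem isInvertible_of_injective {V : Type*} [NormedAddCommGroup V] [NormedSpace ℝ V]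
    [FiniteDimensional ℝ V] (A : V →L[ℝ] V →L[ℝ] ℝ) (hA : ∀ v, A v = 0 → v = 0) :
    A.IsInvertible := by
  have hinj : Function.Injective (A : V →ₗ[ℝ] V →L[ℝ] ℝ) :=
    (injective_iff_map_eq_zero _).2 hA
  have e₁ : (V →L[ℝ] ℝ) ≃ₗ[ℝ] Module.Dual ℝ V := LinearMap.toContinuousLinearMap.symm
  have hfin : FiniteDimensional ℝ (V →L[ℝ] ℝ) := e₁.symm.finiteDimensional
  have hrank : Module.finrank ℝ V = Module.finrank ℝ (V →L[ℝ] ℝ) := by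
    rw [e₁.finrank_eq, Subspace.dual_finrank_eq]
  let e := (LinearEquiv.ofInjectiveOfFinrankEq _ hinj hrank).toContinuousLinearEquiv
  exact ⟨e, by ext v w; rfl⟩

variable [FiniteDimensional ℝ E]

/-- Only nondegeneracy at the point is assumed, so that this applies to the gauge transformed tuple
without first checking its smoothness. -/
theorem Tuple.nPair_eq_of_nondegenerate {D : Tuple I M} {p : M}
    (h : ∀ V : TangentSpace I p × ℝ, (∀ W, D.ambient p V W = 0) → V = 0)
    {V : TangentSpace I p × ℝ} (hV : ∀ W, D.ambient p V W = W.2) : D.nPair p = V := by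
  have hinv : (D.ambient p).IsInvertible :=
    isInvertible_of_injective (V := E × ℝ) (D.ambient p)
      (fun v hv ↦ h v fun W ↦ congrArg (fun L : (E × ℝ) →L[ℝ] ℝ ↦ L W) hv)
  have : D.ambient p V = ContinuousLinearMap.snd ℝ (TangentSpace I p) ℝ := by
    ext W <;> simp [hV]
  rw [Tuple.nPair, ← this]
  exact hinv.inverse_apply_self V

theorem Tuple.exists_ambient_eq {D : Tuple I M} {p : M}
    (h : ∀ V : TangentSpace I p × ℝ, (∀ W, D.ambient p V W = 0) → V = 0)
    (β : TangentSpace I p →L[ℝ] (TangentSpace I p × ℝ) →L[ℝ] ℝ) :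
    ∃ L : TangentSpace I p →L[ℝ] (TangentSpace I p × ℝ), ∀ v W, D.ambient p (L v) W = β v W := by
  have hinv : (D.ambient p).IsInvertible :=
    isInvertible_of_injective (V := E × ℝ) (D.ambient p)
      (fun v hv ↦ h v fun W ↦ congrArg (fun L : (E × ℝ) →L[ℝ] ℝ ↦ L W) hv)
  obtain ⟨e, he⟩ := hinv
  refine ⟨(e.symm : _ →L[ℝ] _).comp β, fun v W ↦ ?_⟩
  rw [← he]
  simp

theorem Tuple.ambient_nPair {D : Tuple I M} {p : M}
    (h : ∀ V : TangentSpace I p × ℝ, (∀ W, D.ambient p V W = 0) → V = 0)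
    (W : TangentSpace I p × ℝ) : D.ambient p (D.nPair p) W = W.2 := by
  have hinv : (D.ambient p).IsInvertible :=
    isInvertible_of_injective (V := E × ℝ) (D.ambient p)
      (fun v hv ↦ h v fun W ↦ congrArg (fun L : (E × ℝ) →L[ℝ] ℝ ↦ L W) hv)
  rw [Tuple.nPair, hinv.self_apply_inverse]
  rfl

theorem Tuple.K_eq_of_n2_eq_zero [IsManifold I ∞ M] {D : Tuple I M} (h : ∀ p, D.n2 p = 0) {p : M} :
    D.K p = (1 / 2 : ℝ) • lieDeriv D.n D.γ p := by
  have h' : differential (I := I) D.n2 p = 0 := by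
    rw [differential, show D.n2 = fun _ ↦ 0 from funext h]; exact mvfderiv_const 0
  ext v w
  change D.n2 p * D.Y p v w + 1 / 2 * lieDeriv D.n D.γ p v w
    + 1 / 2 * (D.l p v * differential D.n2 p w + differential D.n2 p v * D.l p w) =
    1 / 2 * lieDeriv D.n D.γ p v w
  rw [h', h]
  simp

namespace Tuple.IsNullHypersurfaceData

variable [IsManifold I ∞ M] {D : Tuple I M}

theorem γ_n (hD : D.IsNullHypersurfaceData) (p : M) (w : TangentSpace I p) :
    D.γ p (D.n p) w = 0 := by
  have h := ambient_nPair (hD.nondegenerate p) (w, 0)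
  have h2 : (D.nPair p).2 = 0 := hD.null p
  rw [show D.nPair p = (D.n p, 0) from Prod.ext rfl h2, ambient_apply] at h
  simpa using h

theorem l_n (hD : D.IsNullHypersurfaceData) (p : M) : D.l p (D.n p) = 1 := by
  have h := ambient_nPair (hD.nondegenerate p) (0, 1)
  have h2 : (D.nPair p).2 = 0 := hD.null p
  rw [show D.nPair p = (D.n p, 0) from Prod.ext rfl h2, ambient_apply] at h
  simpa using h

theorem γ_n_right (hD : D.IsNullHypersurfaceData) (p : M) (w : TangentSpace I p) :
    D.γ p w (D.n p) = 0 := by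
  rw [hD.symm_γ, hD.γ_n]

/-- The pairings of `(n, 0)` with `(W, 0)` and `(0, 1)` are the constants 0 and 1. -/
theorem n_contAt (hD : D.IsNullHypersurfaceData) (p : M) (m : ℕ∞) :
    VField.ContAt m D.n p := by
  refine hD.contAt_of_pairing (a := 0) (fun W _ ↦ ?_) ?_
  · simpa [hD.γ_n] using contMDiffAt_const
  · simpa [hD.l_n] using contMDiffAt_const

theorem K_eq (hD : D.IsNullHypersurfaceData) (p : M) :
    D.K p = (1 / 2 : ℝ) • lieDeriv D.n D.γ p :=
  K_eq_of_n2_eq_zero hD.null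

theorem K_apply (hD : D.IsNullHypersurfaceData) {p : M} {X Y : VField I M}
    (hX : X.DiffAt p) (hY : Y.DiffAt p) :
    D.K p (X p) (Y p) = 1 / 2 * (mvfderiv I (fun q ↦ D.γ q (X q) (Y q)) p (D.n p)
      - D.γ p (VectorField.mlieBracket I D.n X p) (Y p)
      - D.γ p (X p) (VectorField.mlieBracket I D.n Y p)) := by
  rw [hD.K_eq, ← lieDeriv_apply (hD.smooth_γ.diffAt p) hX hY]
  rfl

theorem K_symm (hD : D.IsNullHypersurfaceData) (p : M) (v w : TangentSpace I p) :
    D.K p v w = D.K p w v := by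
  obtain ⟨X, hX, rfl⟩ := exists_smoothAt_eq p v
  obtain ⟨Y, hY, rfl⟩ := exists_smoothAt_eq p w
  rw [hD.K_apply hX.diffAt hY.diffAt, hD.K_apply hY.diffAt hX.diffAt]
  rw [show (fun q ↦ D.γ q (Y q) (X q)) = fun q ↦ D.γ q (X q) (Y q) from
    funext fun q ↦ hD.symm_γ q _ _, hD.symm_γ p (VectorField.mlieBracket I D.n X p),
    hD.symm_γ p (X p)]
  ring

theorem K_contMDiffAt (hD : D.IsNullHypersurfaceData) {p : M} {m : ℕ∞} {X Y : VField I M}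
    (hX : X.ContAt (m + 1) p) (hY : Y.ContAt (m + 1) p) :
    ContMDiffAt I 𝓘(ℝ, ℝ) m (fun q ↦ D.K q (X q) (Y q)) p := by
  have : CompleteSpace E := FiniteDimensional.complete ℝ E
  have hle : ((m : ℕ∞) : WithTop ℕ∞) ≤ ((m + 1 : ℕ∞) : WithTop ℕ∞) := by simp
  have h1 : ∀ {Z : VField I M}, Z.ContAt (m + 1) p → Z.ContAt 1 p := fun h ↦
    ContMDiffAt.of_le h (by exact_mod_cast le_add_self)
  have h : ContMDiffAt I 𝓘(ℝ, ℝ) m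
      (fun q ↦ 1 / 2 * (mvfderiv I (fun q ↦ D.γ q (X q) (Y q)) q (D.n q)
      - D.γ q (VectorField.mlieBracket I D.n X q) (Y q)
      - D.γ q (X q) (VectorField.mlieBracket I D.n Y q))) p := by
    refine contMDiffAt_const.mul ((ContMDiffAt.sub ?_ ?_).sub ?_)
    · exact contMDiffAt_mvfderiv_apply (by exact_mod_cast hD.smooth_γ.contMDiffAt_apply hX hY)
        (hD.n_contAt p m)
    · exact hD.smooth_γ.contMDiffAt_apply (VField.ContAt.mlieBracket (hD.n_contAt p _) hX)
        (ContMDiffAt.of_le hY hle)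
    · exact hD.smooth_γ.contMDiffAt_apply (ContMDiffAt.of_le hX hle)
        (VField.ContAt.mlieBracket (hD.n_contAt p _) hY)
  refine h.congr_of_eventuallyEq ?_
  filter_upwards [(h1 hX).eventually_diffAt, (h1 hY).eventually_diffAt] with q hXq hYq
  exact hD.K_apply hXq hYq

end Tuple.IsNullHypersurfaceData

end Normal

/-! ### The Koszul form -/

section Koszul

variable [IsManifold I ∞ M]

/-- The right-hand side of the Koszul formula, for a degenerate metric `γ`. -/
def koszul (γ : TwoTensor I M) (p : M) (Z X W : VField I M) : ℝ :=
  1 / 2 * (mvfderiv I (fun q ↦ γ q (Z q) (W q)) p (X p)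
    + mvfderiv I (fun q ↦ γ q (X q) (W q)) p (Z p)
    - mvfderiv I (fun q ↦ γ q (X q) (Z q)) p (W p)
    + γ p (VectorField.mlieBracket I X Z p) (W p)
    - γ p (VectorField.mlieBracket I Z W p) (X p)
    - γ p (VectorField.mlieBracket I X W p) (Z p))

variable {γ : TwoTensor I M} {p : M} {X Y Z W : VField I M} {f : M → ℝ}

theorem koszul_add [CompleteSpace E] (hγ : γ.DiffAt p) (hX : X.DiffAt p) (hY : Y.DiffAt p)
    (hZ : Z.DiffAt p) (hW : W.DiffAt p) :
    koszul γ p (Y + Z) X W = koszul γ p Y X W + koszul γ p Z X W := by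
  simp only [koszul]
  rw [hγ.mvfderiv_add_left hY hZ hW, hγ.mvfderiv_add_right hX hY hZ,
    VectorField.mlieBracket_add_right hY hZ, VectorField.mlieBracket_add_left hY hZ]
  simp
  ring

theorem koszul_smul [CompleteSpace E] (hγ : γ.DiffAt p) (hs : ∀ v w, γ p v w = γ p w v)
    (hf : MDifferentiableAt I 𝓘(ℝ, ℝ) f p) (hX : X.DiffAt p)
    (hZ : Z.DiffAt p) (hW : W.DiffAt p) :
    koszul γ p (f • Z) X W =
      f p * koszul γ p Z X W + mvfderiv I f p (X p) * γ p (Z p) (W p) := by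
  simp only [koszul]
  rw [hγ.mvfderiv_smul_left hf hZ hW, hγ.mvfderiv_smul_right hf hX hZ,
    VectorField.mlieBracket_smul_right hf hZ, VectorField.mlieBracket_smul_left hf hZ]
  simp
  rw [hs (X p) (Z p)]
  ring

variable [FiniteDimensional ℝ E]

/-- For fixed `Z` the derivative terms of `f` cancel in the slots `X` and `W`, leaving a bilinear
form at `p`. In the slot `Z` one such term survives (`koszul_smul`) and becomes the Leibniz rule of
the connection. -/
theorem exists_koszul_eq (hγ : γ.DiffAt p) (hs : ∀ v w, γ p v w = γ p w v) (hZ : Z.DiffAt p) :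
    ∃ k : TangentSpace I p →L[ℝ] TangentSpace I p →L[ℝ] ℝ,
      ∀ X W : VField I M, X.DiffAt p → W.DiffAt p → k (X p) (W p) = koszul γ p Z X W := by
  have : CompleteSpace E := FiniteDimensional.complete ℝ E
  refine ⟨tensorOf (koszul γ p Z) p, fun X W hX hW ↦
    tensorOf_apply (fun Y hY ↦ ⟨?_, ?_⟩) (fun Y hY ↦ ⟨?_, ?_⟩) hX hW⟩
  · intro f σ hf hσ
    simp only [koszul]
    rw [hγ.mvfderiv_smul_left hf hσ hY, hγ.mvfderiv_smul_left hf hσ hZ,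
      VectorField.mlieBracket_smul_left hf hσ, VectorField.mlieBracket_smul_left hf hσ]
    simp
    ring
  · intro σ σ' hσ hσ'
    simp only [koszul]
    rw [hγ.mvfderiv_add_left hσ hσ' hY, hγ.mvfderiv_add_left hσ hσ' hZ,
      VectorField.mlieBracket_add_left hσ hσ', VectorField.mlieBracket_add_left hσ hσ']
    simp
    ring
  · intro f σ hf hσ
    simp only [koszul]
    rw [hγ.mvfderiv_smul_right hf hZ hσ, hγ.mvfderiv_smul_right hf hY hσ,
      VectorField.mlieBracket_smul_right hf hσ, VectorField.mlieBracket_smul_right hf hσ]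
    simp
    rw [hs (σ p) (Y p), hs (σ p) (Z p)]
    ring
  · intro σ σ' hσ hσ'
    simp only [koszul]
    rw [hγ.mvfderiv_add_right hZ hσ hσ', hγ.mvfderiv_add_right hY hσ hσ',
      VectorField.mlieBracket_add_right hσ hσ', VectorField.mlieBracket_add_right hσ hσ']
    simp
    ring

end Koszul

/-! ### Existence and uniqueness of the connection -/

section Connection

theorem exists_flip_apply {p : M}
    (T : TangentSpace I p →L[ℝ] TangentSpace I p →L[ℝ] ℝ) (w : TangentSpace I p) :
    ∃ L : TangentSpace I p →L[ℝ] ℝ, ∀ v, L v = T v w :=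
  ⟨ContinuousLinearMap.flip (E := E) (F := E) T w, fun _ ↦ rfl⟩

variable [FiniteDimensional ℝ E] [IsManifold I ∞ M] {D : Tuple I M}

theorem Tuple.F_apply {p : M} (hl : D.l.DiffAt p) {X Z : VField I M} (hX : X.DiffAt p)
    (hZ : Z.DiffAt p) :
    D.F p (X p) (Z p) = 1 / 2 * (mvfderiv I (fun q ↦ D.l q (Z q)) p (X p)
      - mvfderiv I (fun q ↦ D.l q (X q)) p (Z p) - D.l p (VectorField.mlieBracket I X Z p)) := by
  rw [← extD_apply hl hX hZ]
  rfl

namespace Tuple.IsNullHypersurfaceData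

/-- Terms containing `γ(·, n)` vanish and what is left is minus half of `L_n γ`. This is the
compatibility condition that makes the Koszul prescription solvable although `γ` is degenerate. -/
theorem koszul_n (hD : D.IsNullHypersurfaceData) {p : M} {X Z : VField I M}
    (hX : X.DiffAt p) (hZ : Z.DiffAt p) : koszul D.γ p Z X D.n = - D.K p (X p) (Z p) := by
  rw [hD.K_apply hX hZ]
  simp only [koszul]
  rw [show (fun q ↦ D.γ q (Z q) (D.n q)) = fun _ ↦ 0 from funext fun q ↦ hD.γ_n_right q _,
    show (fun q ↦ D.γ q (X q) (D.n q)) = fun _ ↦ 0 from funext fun q ↦ hD.γ_n_right q _,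
    hD.γ_n_right, mvfderiv_const, VectorField.mlieBracket_swap_apply (V := Z),
    VectorField.mlieBracket_swap_apply (V := X) (W := D.n),
    hD.symm_γ p (X p) (VectorField.mlieBracket I D.n Z p)]
  simp
  ring

/-- The covariant derivative `∇ Z` at `p` exists, as a linear map characterized by its pairings
with `γ` and `ℓ`. -/
theorem exists_covariantDerivative_apply (hD : D.IsNullHypersurfaceData) (p : M) (Z : VField I M) :
    ∃ L : TangentSpace I p →L[ℝ] TangentSpace I p, Z.DiffAt p →
      (∀ X W : VField I M, X.DiffAt p → W.DiffAt p →
        D.γ p (L (X p)) (W p) = koszul D.γ p Z X W + D.l p (W p) * D.K p (X p) (Z p)) ∧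
      (∀ v, D.l p (L v) = mvfderiv I (fun q ↦ D.l q (Z q)) p v
        - (D.Y p v (Z p) + D.F p v (Z p) - D.l2 p * D.K p v (Z p))) := by
  by_cases hZ : Z.DiffAt p
  swap
  -- The value on non-differentiable fields is arbitrary; it lets `choose` produce a total operator.
  · exact ⟨0, fun h ↦ absurd h hZ⟩
  obtain ⟨k, hk⟩ := exists_koszul_eq (hD.smooth_γ.diffAt p) (hD.symm_γ p) hZ
  obtain ⟨KZ, hKZ⟩ := exists_flip_apply (D.K p) (Z p)
  obtain ⟨YZ, hYZ⟩ := exists_flip_apply (D.Y p) (Z p)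
  obtain ⟨FZ, hFZ⟩ := exists_flip_apply (D.F p) (Z p)
  let π₁ := ContinuousLinearMap.fst ℝ (TangentSpace I p) ℝ
  let π₂ := ContinuousLinearMap.snd ℝ (TangentSpace I p) ℝ
  let β₁ : TangentSpace I p →L[ℝ] TangentSpace I p →L[ℝ] ℝ :=
    k + KZ.smulRight (D.l p)
  let β₂ : TangentSpace I p →L[ℝ] ℝ := mvfderiv I (fun q ↦ D.l q (Z q)) p
    - (YZ + FZ - D.l2 p • KZ)
  obtain ⟨L, hL⟩ := exists_ambient_eq (hD.nondegenerate p)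
    ((ContinuousLinearMap.precomp ℝ π₁).comp β₁ + β₂.smulRight π₂)
  have hβ₁ : ∀ v w, β₁ v w = k v w + D.l p w * D.K p v (Z p) := fun v w ↦ by
    simp [β₁, hKZ, mul_comm]
  have hβ₂ : ∀ v, β₂ v = mvfderiv I (fun q ↦ D.l q (Z q)) p v
        - (D.Y p v (Z p) + D.F p v (Z p) - D.l2 p * D.K p v (Z p)) := fun v ↦ by simp [β₂, hKZ, hYZ, hFZ]
  have hL' : ∀ v w b, D.ambient p (L v) (w, b) = β₁ v w + β₂ v * b := fun v w b ↦ by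
    rw [hL]
    simp [π₁, π₂]
  -- Inverting `𝒜` gives a solution in `T_p M × ℝ`; it is a tangent vector only if its scalar part
  -- vanishes. Pairing with `(n, 0)` reads off that part, and by `koszul_n` it is `-K + K`.
  have h0 : ∀ v, (L v).2 = 0 := by
    intro v
    have h1 : D.ambient p ((L v).1, (L v).2) (D.n p, 0) = (L v).2 := by
      rw [ambient_apply, hD.γ_n_right, hD.l_n]
      ring
    obtain ⟨X, hX, rfl⟩ := exists_smoothAt_eq p v
    rw [← h1, Prod.mk.eta, hL', hβ₁, hk X D.n hX.diffAt ((hD.n_contAt p 1).diffAt one_ne_zero),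
      hD.koszul_n hX.diffAt hZ, hD.l_n]
    ring
  have hLv : ∀ v, L v = ((L v).1, 0) := fun v ↦ Prod.ext rfl (h0 v)
  refine ⟨π₁.comp L, fun _ ↦ ⟨fun X W hX hW ↦ ?_, fun v ↦ ?_⟩⟩
  · have := hL' (X p) (W p) 0
    rw [hLv, ambient_apply, hβ₁, hk X W hX hW] at this
    simpa [π₁] using this
  · have := hL' v 0 1
    rw [hLv, ambient_apply, hβ₂] at this
    simpa [π₁] using this

/-- Vectors are separated by their pairings with `γ` and `ℓ`, so additivity, the Leibniz rule and
vanishing torsion are checked on those pairings; the other two conditions are the prescription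
rearranged. -/
theorem exists_isConnection (hD : D.IsNullHypersurfaceData) :
    ∃ cov : VFieldOperator I M, D.IsConnection cov := by
  have : CompleteSpace E := FiniteDimensional.complete ℝ E
  choose cov hcov using fun (Z : VField I M) (p : M) ↦ hD.exists_covariantDerivative_apply p Z
  have hγ := fun p ↦ hD.smooth_γ.diffAt p
  have hl := fun p ↦ hD.smooth_l.diffAt p
  refine ⟨cov, ⟨⟨?_, ?_⟩, ?_, ?_, ?_⟩⟩
  · intro σ σ' p hσ hσ' _
    ext v : 1
    obtain ⟨X, hX, rfl⟩ := exists_smoothAt_eq p v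
    obtain ⟨h1, h1'⟩ := hcov _ p (VField.DiffAt.add hσ hσ')
    obtain ⟨h2, h2'⟩ := hcov _ p hσ
    obtain ⟨h3, h3'⟩ := hcov _ p hσ'
    refine hD.eq_of_pairing (fun w ↦ ?_) ?_
    · obtain ⟨W, hW, rfl⟩ := exists_smoothAt_eq p w
      rw [h1 X W hX.diffAt hW.diffAt, koszul_add (hγ p) hX.diffAt hσ hσ' hW.diffAt]
      simp only [add_apply, map_add, Pi.add_apply, h2 X W hX.diffAt hW.diffAt,
        h3 X W hX.diffAt hW.diffAt]
      ring
    · rw [h1', (hl p).mvfderiv_add hσ hσ']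
      simp only [add_apply, map_add, Pi.add_apply, h2', h3']
      ring
  · intro σ f p hσ hf _
    ext v : 1
    obtain ⟨X, hX, rfl⟩ := exists_smoothAt_eq p v
    obtain ⟨h1, h1'⟩ := hcov _ p (VField.DiffAt.smul hf hσ)
    obtain ⟨h2, h2'⟩ := hcov _ p hσ
    refine hD.eq_of_pairing (fun w ↦ ?_) ?_
    · obtain ⟨W, hW, rfl⟩ := exists_smoothAt_eq p w
      rw [h1 X W hX.diffAt hW.diffAt,
        koszul_smul (hγ p) (hD.symm_γ p) hf hX.diffAt hσ hW.diffAt]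
      simp only [add_apply, map_add, Pi.smul_apply', smul_apply, map_smul, smul_eq_mul,
        h2 X W hX.diffAt hW.diffAt, ContinuousLinearMap.smulRight_apply]
      ring
    · rw [h1', (hl p).mvfderiv_smul hf hσ]
      simp only [add_apply, map_add, Pi.smul_apply', smul_apply, map_smul, smul_eq_mul,
        h2', ContinuousLinearMap.smulRight_apply]
      ring
  · intro p X Z hX hZ
    obtain ⟨h1, h1'⟩ := hcov _ p hX
    obtain ⟨h2, h2'⟩ := hcov _ p hZ
    refine hD.eq_of_pairing (fun w ↦ ?_) ?_
    · obtain ⟨W, hW, rfl⟩ := exists_smoothAt_eq p w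
      rw [map_sub, sub_apply, h1 Z W hZ hW.diffAt, h2 X W hX hW.diffAt]
      simp only [koszul]
      rw [hD.K_symm p (Z p) (X p), show (fun q ↦ D.γ q (Z q) (X q)) = fun q ↦ D.γ q (X q) (Z q) from
        funext fun q ↦ hD.symm_γ q _ _, VectorField.mlieBracket_swap_apply (V := Z) (W := X)]
      simp
      ring
    · rw [map_sub, h1', h2', F_apply (hl p) hX hZ, F_apply (hl p) hZ hX, hD.symm_Y p (Z p),
        hD.K_symm p (Z p), VectorField.mlieBracket_swap_apply (V := Z) (W := X)]
      simp
      ring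
  · intro p X Z W hX hZ hW
    obtain ⟨h1, -⟩ := hcov _ p hZ
    obtain ⟨h2, -⟩ := hcov _ p hW
    rw [covDeriv₂, h1 X W hX hW, hD.symm_γ p (Z p), h2 X Z hX hZ]
    simp only [koszul]
    rw [show (fun q ↦ D.γ q (W q) (Z q)) = fun q ↦ D.γ q (Z q) (W q) from
        funext fun q ↦ hD.symm_γ q _ _, VectorField.mlieBracket_swap_apply (V := W) (W := Z)]
    simp
    ring
  · intro p X Z hX hZ
    rw [covDeriv₁, (hcov _ p hZ).2]
    ring

theorem isConnection_connection (hD : D.IsNullHypersurfaceData) :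
    D.IsConnection D.connection :=
  Classical.epsilon_spec hD.exists_isConnection

end Tuple.IsNullHypersurfaceData

/-- Two connections of the same data agree on differentiable vector fields. -/
theorem Tuple.IsConnection.eq_of_diffAt {cov cov' : VFieldOperator I M} (h : D.IsConnection cov)
    (h' : D.IsConnection cov') {p : M} (hs : ∀ v w, D.γ p v w = D.γ p w v)
    (hker : ∀ v, (∀ w, D.γ p v w = 0) → D.l p v = 0 → v = 0)
    {Z : VField I M} (hZ : Z.DiffAt p) : cov Z p = cov' Z p := by
  ext v : 1
  obtain ⟨X, hX, rfl⟩ := exists_smoothAt_eq p v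
  let S : VField I M → VField I M → TangentSpace I p :=
    fun X Z ↦ cov Z p (X p) - cov' Z p (X p)
  have hsymm : ∀ X Z : VField I M, X.DiffAt p → Z.DiffAt p → S X Z = S Z X := by
    intro X Z hX hZ
    have := (h.torsion_free p X Z hX hZ).trans (h'.torsion_free p X Z hX hZ).symm
    simp only [S]
    rw [sub_eq_sub_iff_add_eq_add] at this ⊢
    rw [this, add_comm]
  -- Both connections have the same `∇γ`, so `γ(S(X, ·), ·)` is antisymmetric.
  have hanti : ∀ X Z W : VField I M, X.DiffAt p → Z.DiffAt p → W.DiffAt p →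
      D.γ p (S X Z) (W p) = - D.γ p (S X W) (Z p) := by
    intro X Z W hX hZ hW
    have := (h.covDeriv_γ p X Z W hX hZ hW).trans (h'.covDeriv_γ p X Z W hX hZ hW).symm
    simp only [covDeriv₂] at this
    simp only [S, map_sub, sub_apply, hs _ (Z p)]
    linear_combination -this
  rw [← sub_eq_zero]
  refine hker _ (fun w ↦ ?_) ?_
  · obtain ⟨W, hW, rfl⟩ := exists_smoothAt_eq p w
    have hX := hX.diffAt
    have hW := hW.diffAt
    change D.γ p (S X Z) (W p) = 0
    -- A trilinear expression symmetric in its first two slots and antisymmetric in its last two is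
    -- zero: three alternating swaps return it with the opposite sign.
    have e1 := hanti X Z W hX hZ hW
    have e2 := hanti W X Z hW hX hZ
    have e3 := hanti Z W X hZ hW hX
    rw [hsymm W X hW hX, hsymm W Z hW hZ] at e2
    rw [hsymm Z X hZ hX] at e3
    linarith
  · have := (h.covDeriv_l p X Z hX.diffAt hZ).trans (h'.covDeriv_l p X Z hX.diffAt hZ).symm
    simp only [covDeriv₁] at this
    rw [map_sub]
    linear_combination -this

end Connection

/-! ### Regularity of the connection -/

section Regularity

variable [FiniteDimensional ℝ E] [IsManifold I ∞ M] {D : Tuple I M} {cov : VFieldOperator I M}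
  {p : M} {X Y Z W : VField I M}

theorem TwoTensor.Smooth.koszul_contMDiffAt {γ : TwoTensor I M} (hγ : γ.Smooth) {m : ℕ∞}
    (hZ : Z.ContAt (m + 1) p) (hX : X.ContAt (m + 1) p) (hW : W.ContAt (m + 1) p) :
    ContMDiffAt I 𝓘(ℝ, ℝ) m (fun q ↦ koszul γ q Z X W) p := by
  have : CompleteSpace E := FiniteDimensional.complete ℝ E
  have h {A B C : VField I M} (hA : A.ContAt (m + 1) p) (hB : B.ContAt (m + 1) p)
      (hC : C.ContAt (m + 1) p) :
      ContMDiffAt I 𝓘(ℝ, ℝ) m (fun q ↦ mvfderiv I (fun q ↦ γ q (A q) (B q)) q (C q)) p :=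
    contMDiffAt_mvfderiv_apply (by exact_mod_cast hγ.contMDiffAt_apply hA hB) hC.of_succ
  have h' {A B C : VField I M} (hA : A.ContAt (m + 1) p) (hB : B.ContAt (m + 1) p)
      (hC : C.ContAt (m + 1) p) :
      ContMDiffAt I 𝓘(ℝ, ℝ) m (fun q ↦ γ q (VectorField.mlieBracket I A B q) (C q)) p :=
    hγ.contMDiffAt_apply (VField.ContAt.mlieBracket hA hB) hC.of_succ
  exact contMDiffAt_const.mul ((((((h hZ hW hX).add (h hX hW hZ)).sub (h hX hZ hW)).add
    (h' hX hZ hW)).sub (h' hZ hW hX)).sub (h' hX hW hZ))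

namespace Tuple

theorem IsHypersurfaceData.F_contMDiffAt (hD : D.IsHypersurfaceData) {m : ℕ∞}
    (hX : X.ContAt (m + 1) p) (hZ : Z.ContAt (m + 1) p) :
    ContMDiffAt I 𝓘(ℝ, ℝ) m (fun q ↦ D.F q (X q) (Z q)) p := by
  have : CompleteSpace E := FiniteDimensional.complete ℝ E
  have h {A B : VField I M} (hA : A.ContAt (m + 1) p) (hB : B.ContAt (m + 1) p) :
      ContMDiffAt I 𝓘(ℝ, ℝ) m (fun q ↦ mvfderiv I (fun q ↦ D.l q (A q)) q (B q)) p :=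
    contMDiffAt_mvfderiv_apply (by exact_mod_cast hD.smooth_l.contMDiffAt_apply hA) hB.of_succ
  refine (contMDiffAt_const (c := (1 / 2 : ℝ)).mul (((h hZ hX).sub (h hX hZ)).sub
    (hD.smooth_l.contMDiffAt_apply (VField.ContAt.mlieBracket hX hZ)))).congr_of_eventuallyEq ?_
  filter_upwards [hX.one_of_succ.eventually_diffAt, hZ.one_of_succ.eventually_diffAt]
    with q hXq hZq
  exact F_apply (hD.smooth_l.diffAt q) hXq hZq

namespace IsNullHypersurfaceData

/-- The usual cyclic combination of the three `∇γ` equations. The terms with `ℓ(X)` and `ℓ(Z)`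
cancel, and the two with `ℓ(W)` add up. -/
theorem γ_connection (hD : D.IsNullHypersurfaceData) (hc : D.IsConnection cov)
    (hX : X.DiffAt p) (hZ : Z.DiffAt p) (hW : W.DiffAt p) :
    D.γ p (cov Z p (X p)) (W p) = koszul D.γ p Z X W + D.l p (W p) * D.K p (X p) (Z p) := by
  have e1 := hc.covDeriv_γ p X Z W hX hZ hW
  have e2 := hc.covDeriv_γ p Z X W hZ hX hW
  have e3 := hc.covDeriv_γ p W X Z hW hX hZ
  simp only [covDeriv₂] at e1 e2 e3
  simp only [koszul]
  rw [← hc.torsion_free p X Z hX hZ, ← hc.torsion_free p Z W hZ hW, ← hc.torsion_free p X W hX hW]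
  simp only [map_sub, sub_apply]
  rw [hD.symm_γ p (Z p)] at e1
  rw [hD.symm_γ p (X p) (cov W p (Z p)), hD.K_symm p (Z p) (X p)] at e2
  rw [hD.symm_γ p (X p), hD.K_symm p (W p) (X p), hD.K_symm p (W p) (Z p)] at e3
  linear_combination (-1 / 2) * (e1 + e2 - e3)

/-- Both pairings of `∇_X Z` involve first derivatives of `X` and `Z`, hence the loss of one order.
The identities for them need differentiability of the fields, so they are used on a neighbourhood
only. -/
theorem connection_contAt (hD : D.IsNullHypersurfaceData) (hc : D.IsConnection cov) {m : ℕ∞}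
    (hX : X.ContAt (m + 1) p) (hZ : Z.ContAt (m + 1) p) :
    VField.ContAt m (fun q ↦ cov Z q (X q) : VField I M) p := by
  have hXq := hX.one_of_succ.eventually_diffAt
  have hZq := hZ.one_of_succ.eventually_diffAt
  refine hD.contAt_of_pairing (a := fun _ ↦ 0) (fun W hW ↦ ?_) ?_
  · have hWm := hW.contAt (m + 1)
    refine ((hD.smooth_γ.koszul_contMDiffAt hZ hX hWm).add
      ((hD.smooth_l.contMDiffAt_apply hWm.of_succ).mul
        (hD.K_contMDiffAt hX hZ))).congr_of_eventuallyEq ?_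
    filter_upwards [hXq, hZq, (hW.contAt 1).eventually_diffAt] with q h1 h2 h3
    simp [hD.γ_connection hc h1 h2 h3]
  · have h1 : ContMDiffAt I 𝓘(ℝ, ℝ) m (fun q ↦ mvfderiv I (fun q ↦ D.l q (Z q)) q (X q)) p :=
      contMDiffAt_mvfderiv_apply (by exact_mod_cast hD.smooth_l.contMDiffAt_apply hZ) hX.of_succ
    have hl2 : ContMDiffAt I 𝓘(ℝ, ℝ) m D.l2 p :=
      (hD.smooth_l2 p).of_le (by exact_mod_cast le_top)
    refine (h1.sub (((hD.smooth_Y.contMDiffAt_apply hX.of_succ hZ.of_succ).add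
      (hD.F_contMDiffAt hX hZ)).sub (hl2.mul (hD.K_contMDiffAt hX hZ)))).congr_of_eventuallyEq ?_
    filter_upwards [hXq, hZq] with q h1 h2
    have := hc.covDeriv_l q X Z h1 h2
    simp only [covDeriv₁] at this
    simp only [Pi.add_apply, Pi.mul_apply]
    linear_combination -this

end IsNullHypersurfaceData

end Tuple

end Regularity

/-! ### The gauge transformed data -/

section Gauge

variable {D : Tuple I M} {z : M → ℝ} {ζ : VField I M} {p : M}

namespace Tuple

@[simp]
theorem gauge_γ [FiniteDimensional ℝ E] [IsManifold I ∞ M] : (D.gauge z ζ).γ = D.γ := rfl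

variable [FiniteDimensional ℝ E] [IsManifold I ∞ M]

theorem gauge_l_apply (v : TangentSpace I p) :
    (D.gauge z ζ).l p v = z p * (D.l p v + D.γ p (ζ p) v) := rfl

theorem gauge_l2_apply : (D.gauge z ζ).l2 p =
    z p ^ 2 * (D.l2 p + 2 * D.l p (ζ p) + D.γ p (ζ p) (ζ p)) := rfl

theorem gauge_Y_apply (v w : TangentSpace I p) : (D.gauge z ζ).Y p v w =
    z p * D.Y p v w + 1 / 2 * (D.l p v * mvfderiv I z p w + mvfderiv I z p v * D.l p w)
      + 1 / 2 * lieDeriv (z • ζ) D.γ p v w := rfl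

/-- A gauge transformation is a change of the transversal direction: `(0, 1)` goes to `(z ζ, z)`.
Nondegeneracy of the new form and the new `n` are read off from this point of view. -/
theorem gauge_ambient (hs : ∀ v w, D.γ p v w = D.γ p w v) (v w : TangentSpace I p) (a b : ℝ) :
    (D.gauge z ζ).ambient p (v, a) (w, b) =
      D.ambient p (v + (a * z p) • ζ p, z p * a) (w + (b * z p) • ζ p, z p * b) := by
  rw [ambient_apply, ambient_apply, gauge_l_apply, gauge_l_apply, gauge_l2_apply, gauge_γ]
  simp only [map_add, map_smul, add_apply, smul_apply, smul_eq_mul]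
  rw [hs v (ζ p)]
  ring

namespace IsNullHypersurfaceData

variable (hD : D.IsNullHypersurfaceData)

include hD

theorem gauge_nondegenerate (hz : z p ≠ 0) (V : TangentSpace I p × ℝ)
    (hV : ∀ W, (D.gauge z ζ).ambient p V W = 0) : V = 0 := by
  obtain ⟨v, a⟩ := V
  have h := hD.nondegenerate p (v + (a * z p) • ζ p, z p * a) (fun ⟨w, b⟩ ↦ by
    -- The preimage of `(w, b)` under the map `(v, a) ↦ (v + a z ζ, z a)`.
    have := hV (w - b • ζ p, b / z p)
    rwa [gauge_ambient (hD.symm_γ p), div_mul_cancel₀ _ hz, sub_add_cancel,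
      mul_div_cancel₀ _ hz] at this)
  obtain ⟨h1, h2⟩ := Prod.mk_eq_zero.1 h
  have ha : a = 0 := by simpa [hz] using h2
  subst ha
  simpa using h1

theorem gauge_nPair (hz : z p ≠ 0) : (D.gauge z ζ).nPair p = ((z p)⁻¹ • D.n p, 0) := by
  refine nPair_eq_of_nondegenerate (hD.gauge_nondegenerate hz) fun ⟨w, b⟩ ↦ ?_
  rw [ambient_apply, gauge_l_apply, gauge_l_apply, gauge_γ]
  simp only [map_smul, smul_apply, smul_eq_mul, hD.γ_n, hD.γ_n_right, hD.l_n]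
  field_simp
  ring

theorem gauge_n (hz : ∀ p, z p ≠ 0) : (D.gauge z ζ).n = (fun q ↦ (z q)⁻¹) • D.n :=
  funext fun p ↦ congrArg Prod.fst (hD.gauge_nPair (hz p))

/-- In `L_{f n} γ` with `f = z⁻¹`, the derivatives of `f` are multiplied by `γ(n, ·) = 0`, so `f`
factors out. -/
theorem gauge_K (hz : ∀ p, z p ≠ 0) (hz' : ContMDiffAt I 𝓘(ℝ, ℝ) ∞ z p)
    (v w : TangentSpace I p) : (D.gauge z ζ).K p v w = (z p)⁻¹ * D.K p v w := by
  have : CompleteSpace E := FiniteDimensional.complete ℝ E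
  have hn2 : ∀ p, (D.gauge z ζ).n2 p = 0 := fun p ↦ congrArg Prod.snd (hD.gauge_nPair (hz p))
  rw [K_eq_of_n2_eq_zero hn2, hD.K_eq, hD.gauge_n hz]
  obtain ⟨X, hX, rfl⟩ := exists_smoothAt_eq p v
  obtain ⟨Y, hY, rfl⟩ := exists_smoothAt_eq p w
  have hn : D.n.DiffAt p := (hD.n_contAt p 1).diffAt one_ne_zero
  have hz1 : MDifferentiableAt I 𝓘(ℝ, ℝ) (fun q ↦ (z q)⁻¹) p :=
    (hz'.inv₀ (hz p)).mdifferentiableAt (by simp)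
  simp only [smul_apply, smul_eq_mul]
  rw [gauge_γ, lieDeriv_apply (hD.smooth_γ.diffAt p) hX.diffAt hY.diffAt,
    lieDeriv_apply (hD.smooth_γ.diffAt p) hX.diffAt hY.diffAt,
    VectorField.mlieBracket_smul_left hz1 hn, VectorField.mlieBracket_smul_left hz1 hn]
  simp [hD.γ_n, hD.γ_n_right]
  ring

end IsNullHypersurfaceData

end Tuple

end Gauge

/-! ### The connection of the gauge transformed data -/

section GaugeConnection

variable [FiniteDimensional ℝ E] [IsManifold I ∞ M] {D : Tuple I M} {z : M → ℝ} {ζ : VField I M}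
  {cov : VFieldOperator I M} {p : M} {X Y Z W : VField I M}

namespace Tuple

/-- The covariant derivative `∇_X W + K(X, W) ζ`. -/
def shift (D : Tuple I M) (ζ : VField I M) (cov : VFieldOperator I M) : VFieldOperator I M :=
  fun W p ↦ cov W p + (D.K p (W p)).smulRight (ζ p)

theorem shift_apply (v : TangentSpace I p) :
    D.shift ζ cov W p v = cov W p v + D.K p (W p) v • ζ p := rfl

theorem gauge_l_diffAt (hD : D.IsHypersurfaceData) (hz : ContMDiff I 𝓘(ℝ, ℝ) ∞ z)
    (hζ : ζ.Smooth) : (D.gauge z ζ).l.DiffAt p := fun _ hX ↦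
  ((hz p).mdifferentiableAt (by simp)).mul ((hD.smooth_l.mdifferentiableAt_apply hX).add
    (hD.smooth_γ.mdifferentiableAt_apply ((hζ p).mdifferentiableAt (by simp)) hX))

theorem mvfderiv_gauge_l (hD : D.IsHypersurfaceData) (hz : ContMDiff I 𝓘(ℝ, ℝ) ∞ z)
    (hζ : ζ.Smooth) (hW : W.DiffAt p) (v : TangentSpace I p) :
    mvfderiv I (fun q ↦ (D.gauge z ζ).l q (W q)) p v =
      (D.l p (W p) + D.γ p (ζ p) (W p)) * mvfderiv I z p v
      + z p * (mvfderiv I (fun q ↦ D.l q (W q)) p v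
        + mvfderiv I (fun q ↦ D.γ q (ζ q) (W q)) p v) := by
  have h1 := hD.smooth_l.mdifferentiableAt_apply hW
  have h2 := hD.smooth_γ.mdifferentiableAt_apply ((hζ p).mdifferentiableAt (by simp)) hW
  have := mvfderiv_mul_apply (v := v) ((hz p).mdifferentiableAt (by simp)) (h1.add h2)
  simp only [gauge_l_apply]
  refine this.trans ?_
  rw [← mvfderiv_add_apply h1 h2]
  simp only [Pi.add_apply]
  rw [add_comm]
  rfl

theorem mvfderiv_gauge_l2 (hD : D.IsHypersurfaceData) (hz : ContMDiff I 𝓘(ℝ, ℝ) ∞ z)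
    (hζ : ζ.Smooth) (v : TangentSpace I p) :
    mvfderiv I (D.gauge z ζ).l2 p v =
      2 * z p * mvfderiv I z p v * (D.l2 p + 2 * D.l p (ζ p) + D.γ p (ζ p) (ζ p))
      + z p ^ 2 * (mvfderiv I D.l2 p v + 2 * mvfderiv I (fun q ↦ D.l q (ζ q)) p v
        + mvfderiv I (fun q ↦ D.γ q (ζ q) (ζ q)) p v) := by
  have hζp : ζ.DiffAt p := (hζ p).mdifferentiableAt (by simp)
  have h0 : MDifferentiableAt I 𝓘(ℝ, ℝ) z p := (hz p).mdifferentiableAt (by simp)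
  have h1 := hD.smooth_l.mdifferentiableAt_apply hζp
  have h2 := hD.smooth_γ.mdifferentiableAt_apply hζp hζp
  have h3 : MDifferentiableAt I 𝓘(ℝ, ℝ) D.l2 p := (hD.smooth_l2 p).mdifferentiableAt (by simp)
  have hc : MDifferentiableAt I 𝓘(ℝ, ℝ) (fun _ : M ↦ (2 : ℝ)) p := mdifferentiableAt_const
  have e1 := mvfderiv_mul_apply (v := v) (h0.mul h0) ((h3.add (hc.mul h1)).add h2)
  have e2 := mvfderiv_mul_apply (v := v) h0 h0
  have e3 := mvfderiv_add_apply (v := v) (h3.add (hc.mul h1)) h2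
  have e4 := mvfderiv_add_apply (v := v) h3 (hc.mul h1)
  have e5 := mvfderiv_mul_apply (v := v) hc h1
  rw [mvfderiv_const] at e5
  have : (D.gauge z ζ).l2 = fun q ↦ (z q * z q) * (D.l2 q + 2 * D.l q (ζ q) + D.γ q (ζ q) (ζ q)) := by
    funext q; rw [gauge_l2_apply]; ring
  rw [this]
  refine e1.trans ?_
  have e6 : mvfderiv I (D.l2 + (fun _ ↦ 2) * (fun q ↦ D.l q (ζ q)) + fun q ↦ D.γ q (ζ q) (ζ q)) p v =
      mvfderiv I D.l2 p v + 2 * mvfderiv I (fun q ↦ D.l q (ζ q)) p v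
        + mvfderiv I (fun q ↦ D.γ q (ζ q) (ζ q)) p v := by
    refine e3.trans ?_
    congr 1
    refine e4.trans ?_
    congr 1
    refine e5.trans ?_
    simp
  rw [e6, show mvfderiv I (z * z) p v = _ from e2]
  simp only [Pi.add_apply, Pi.mul_apply]
  ring

/-- Torsion is unaffected because `K` is symmetric. In `∇γ` the added terms `γ(ζ, ·) K` are the
change of `ℓ'`, with the factor `z` in `ℓ'` offset by `K' = z⁻¹ K`. The condition on `∇ℓ` is the one
that forces the law for `Y'`. -/
theorem IsNullHypersurfaceData.isConnection_shift (hD : D.IsNullHypersurfaceData)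
    (hz : ContMDiff I 𝓘(ℝ, ℝ) ∞ z) (hz0 : ∀ p, z p ≠ 0) (hζ : ζ.Smooth)
    (hc : D.IsConnection cov) : (D.gauge z ζ).IsConnection (D.shift ζ cov) := by
  have : CompleteSpace E := FiniteDimensional.complete ℝ E
  have hζd : ∀ p, ζ.DiffAt p := fun p ↦ (hζ p).mdifferentiableAt (by simp)
  have hzd : ∀ p, MDifferentiableAt I 𝓘(ℝ, ℝ) z p := fun p ↦ (hz p).mdifferentiableAt (by simp)
  have htor : ∀ (p : M) (X Z : VField I M), X.DiffAt p → Z.DiffAt p →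
      D.shift ζ cov Z p (X p) - D.shift ζ cov X p (Z p) = VectorField.mlieBracket I X Z p := by
    intro p X Z hX hZ
    rw [← hc.torsion_free p X Z hX hZ, shift_apply, shift_apply, hD.K_symm p (Z p)]
    abel
  refine ⟨⟨?_, ?_⟩, htor, ?_, ?_⟩
  · intro σ σ' p hσ hσ' _
    ext v : 1
    simp only [shift_apply, add_apply, hc.isCovariantDerivative.add hσ hσ', Pi.add_apply, map_add,
      add_smul]
    abel
  · intro σ f p hσ hf _
    ext v : 1
    simp only [shift_apply, add_apply, hc.isCovariantDerivative.leibniz hσ hf, Pi.smul_apply',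
      map_smul, smul_apply, smul_eq_mul, ContinuousLinearMap.smulRight_apply]
    module
  · intro p X Z W hX hZ hW
    have := hc.covDeriv_γ p X Z W hX hZ hW
    simp only [covDeriv₂] at this
    simp only [covDeriv₂, gauge_γ, gauge_l_apply, hD.gauge_K hz0 (hz p), shift_apply, map_add,
      map_smul, add_apply, smul_apply, smul_eq_mul]
    rw [hD.K_symm p (Z p), hD.K_symm p (W p), hD.symm_γ p (Z p) (ζ p)]
    have hzp := hz0 p
    field_simp
    linear_combination this
  · intro p X Z hX hZ
    have hFs := F_apply (gauge_l_diffAt (p := p) hD.toIsHypersurfaceData hz hζ) hX hZ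
    have f1 := F_apply (hD.smooth_l.diffAt p) hX hZ
    have f2 := F_apply (hD.smooth_l.diffAt p) hZ hX
    have l1 := hc.covDeriv_l p X Z hX hZ
    have l2 := hc.covDeriv_l p Z X hZ hX
    have g1 := hc.covDeriv_γ p X ζ Z hX (hζd p) hZ
    have g2 := hc.covDeriv_γ p Z ζ X hZ (hζd p) hX
    have g3 := hc.covDeriv_γ p ζ X Z (hζd p) hX hZ
    have hzp := hz0 p
    rw [covDeriv₁, hFs, gauge_Y_apply, lieDeriv_apply (hD.smooth_γ.diffAt p) hX hZ,
      VectorField.mlieBracket_smul_left (hzd p) (hζd p),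
      VectorField.mlieBracket_smul_left (hzd p) (hζd p),
      mvfderiv_gauge_l hD.toIsHypersurfaceData hz hζ hX,
      mvfderiv_gauge_l hD.toIsHypersurfaceData hz hζ hZ, hD.gauge_K hz0 (hz p),
      ← hc.torsion_free p X Z hX hZ, ← hc.torsion_free p ζ X (hζd p) hX,
      ← hc.torsion_free p ζ Z (hζd p) hZ]
    rw [← hc.torsion_free p X Z hX hZ] at f1
    rw [← hc.torsion_free p Z X hZ hX] at f2
    simp only [covDeriv₁, covDeriv₂] at l1 l2 g1 g2 g3
    simp only [gauge_l_apply, gauge_l2_apply, shift_apply, map_add, map_sub, map_smul, map_neg,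
      add_apply, sub_apply, smul_apply, neg_apply, Pi.smul_apply', smul_eq_mul, neg_smul] at f1 f2 ⊢
    rw [hD.K_symm p (Z p) (X p)] at *
    rw [hD.symm_Y p (Z p) (X p)] at l2
    rw [hD.K_symm p (Z p) (ζ p)] at g2
    rw [hD.K_symm p (X p) (ζ p)] at g1
    simp only [hD.symm_γ p (X p) (ζ p), hD.symm_γ p (X p) (cov _ _ _)] at *
    have hzz : z p * (z p)⁻¹ = 1 := mul_inv_cancel₀ hzp
    -- `l1 + l2` is the symmetric part of `∇ℓ` and `f1 + f2` the antisymmetry of `F`; the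
    -- combination `g1 + g2 - g3` turns the derivatives of `γ` along and against `ζ` into covariant
    -- ones.
    linear_combination z p / 2 * (l1 + l2 + f1 + f2 + g1 + g2 - g3)
      + z p * (D.l2 p + 2 * D.l p (ζ p) + D.γ p (ζ p) (ζ p)) * D.K p (X p) (Z p) * hzz

end Tuple

end GaugeConnection

/-! ### Gauge transformation of the curvature -/

section GaugeCurvature

variable [FiniteDimensional ℝ E] [IsManifold I ∞ M] {D : Tuple I M} {z : M → ℝ} {ζ : VField I M}
  {p : M} {W X Y Z : VField I M}

namespace Tuple.IsNullHypersurfaceData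

/-- Uniqueness is applied with only symmetry of `γ` and the trivial common kernel of `γ` and `ℓ'`.
The latter is inherited: on the kernel of `γ`, `ℓ'` is `z ℓ`. -/
theorem gauge_connection (hD : D.IsNullHypersurfaceData)
    (hz : ContMDiff I 𝓘(ℝ, ℝ) ∞ z) (hz0 : ∀ p, z p ≠ 0) (hζ : ζ.Smooth) (hX : X.DiffAt p) :
    (D.gauge z ζ).connection X p = D.shift ζ D.connection X p := by
  have hs := hD.isConnection_shift hz hz0 hζ hD.isConnection_connection
  refine IsConnection.eq_of_diffAt (Classical.epsilon_spec ⟨_, hs⟩) hs (hD.symm_γ p)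
    (fun v h₁ h₂ ↦ hD.eq_zero_of_pairing h₁ ?_) hX
  rw [gauge_l_apply, hD.symm_γ, show D.γ p v (ζ p) = 0 from h₁ _] at h₂
  simpa [hz0 p] using h₂

theorem isConnection_gauge_connection (hD : D.IsNullHypersurfaceData)
    (hz : ContMDiff I 𝓘(ℝ, ℝ) ∞ z) (hz0 : ∀ p, z p ≠ 0) (hζ : ζ.Smooth) :
    (D.gauge z ζ).IsConnection (D.gauge z ζ).connection :=
  Classical.epsilon_spec ⟨_, hD.isConnection_shift hz hz0 hζ hD.isConnection_connection⟩

theorem K_mdifferentiableAt (hD : D.IsNullHypersurfaceData) (hX : X.SmoothAt p)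
    (hY : Y.SmoothAt p) : MDifferentiableAt I 𝓘(ℝ, ℝ) (fun q ↦ D.K q (X q) (Y q)) p :=
  (hD.K_contMDiffAt (m := 1) (hX.contAt _) (hY.contAt _)).mdifferentiableAt (by simp)

/-- The iterated covariant derivative `∇'_Y ∇'_Z X` in terms of `∇`. -/
theorem gauge_connection_connection (hD : D.IsNullHypersurfaceData)
    (hz : ContMDiff I 𝓘(ℝ, ℝ) ∞ z) (hz0 : ∀ p, z p ≠ 0) (hζ : ζ.Smooth)
    (hX : X.SmoothAt p) (hZ : Z.SmoothAt p) (v : TangentSpace I p) :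
    (D.gauge z ζ).connection (fun q ↦ (D.gauge z ζ).connection X q (Z q)) p v =
      D.connection (fun q ↦ D.connection X q (Z q)) p v
      + D.K p (X p) (Z p) • D.connection ζ p v
      + (mvfderiv I (fun q ↦ D.K q (X q) (Z q)) p v + D.K p (D.connection X p (Z p)) v
        + D.K p (X p) (Z p) * D.K p (ζ p) v) • ζ p := by
  let f : M → ℝ := fun q ↦ D.K q (X q) (Z q)
  let V : VField I M := fun q ↦ D.connection X q (Z q)
  have hf : MDifferentiableAt I 𝓘(ℝ, ℝ) f p := hD.K_mdifferentiableAt hX hZ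
  have hζp : ζ.DiffAt p := (hζ p).mdifferentiableAt (by simp)
  have hV : V.DiffAt p := (hD.connection_contAt hD.isConnection_connection (m := 1)
    (hZ.contAt _) (hX.contAt _)).diffAt one_ne_zero
  have hVf : VField.DiffAt (V + f • ζ) p := hV.add (VField.DiffAt.smul hf hζp)
  -- The formula for `∇'` holds only where `X` is differentiable, so the inner field is replaced
  -- near `p` and locality of the outer derivative is used.
  have heq : ∀ᶠ q in 𝓝 p, (D.gauge z ζ).connection X q (Z q) = (V + f • ζ) q := by
    filter_upwards [(hX.contAt 1).eventually_diffAt] with q hq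
    rw [hD.gauge_connection hz hz0 hζ hq, shift_apply]
    rfl
  have hV' : VField.DiffAt (fun q ↦ (D.gauge z ζ).connection X q (Z q)) p :=
    hVf.congr_of_eventuallyEq (heq.mono fun q hq ↦ by simp only [hq])
  have hcd := hD.isConnection_connection.isCovariantDerivative
  rw [(hD.isConnection_gauge_connection hz hz0 hζ).isCovariantDerivative.congr_of_eventuallyEq
    hV' hVf Filter.univ_mem heq, hD.gauge_connection hz hz0 hζ hVf, shift_apply,
    hcd.add hV (VField.DiffAt.smul hf hζp), hcd.leibniz hζp hf]
  simp only [add_apply, smul_apply, Pi.add_apply, Pi.smul_apply', map_add, map_smul, smul_eq_mul,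
    ContinuousLinearMap.smulRight_apply, f, V]
  module

/-- Antisymmetrizing the second derivatives leaves the derivatives of `K(X, Z)` and `K(X, Y)`; with
`[Y, Z]` rewritten by vanishing torsion, they assemble into the antisymmetrized `∇K`. -/
theorem gauge_curvature (hD : D.IsNullHypersurfaceData)
    (hz : ContMDiff I 𝓘(ℝ, ℝ) ∞ z) (hz0 : ∀ p, z p ≠ 0) (hζ : ζ.Smooth)
    (hX : X.SmoothAt p) (hY : Y.SmoothAt p) (hZ : Z.SmoothAt p) :
    curvature (D.gauge z ζ).connection Y Z X p = curvature D.connection Y Z X p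
      + D.K p (X p) (Z p) • D.connection ζ p (Y p) - D.K p (X p) (Y p) • D.connection ζ p (Z p)
      + (covDeriv₂ D.connection D.K Y Z X p - covDeriv₂ D.connection D.K Z Y X p
        + D.K p (X p) (Z p) * D.K p (ζ p) (Y p) - D.K p (X p) (Y p) * D.K p (ζ p) (Z p)) • ζ p := by
  have ht := hD.isConnection_connection.torsion_free p Y Z hY.diffAt hZ.diffAt
  simp only [curvature, covDeriv₂]
  rw [hD.gauge_connection_connection hz hz0 hζ hX hZ, hD.gauge_connection_connection hz hz0 hζ hX hY,
    hD.gauge_connection hz hz0 hζ hX.diffAt, shift_apply, ← ht]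
  have hs : ∀ Z : VField I M, (fun q ↦ D.K q (Z q) (X q)) = fun q ↦ D.K q (X q) (Z q) := fun Z ↦
    funext fun q ↦ hD.K_symm q _ _
  rw [hs, hs, hD.K_symm p (D.connection Y p (Z p)), hD.K_symm p (D.connection Z p (Y p)),
    hD.K_symm p (Z p), hD.K_symm p (Y p)]
  simp only [map_sub]
  module

theorem mvfderiv_gauge_K (hD : D.IsNullHypersurfaceData)
    (hz : ContMDiff I 𝓘(ℝ, ℝ) ∞ z) (hz0 : ∀ p, z p ≠ 0)
    (hX : X.SmoothAt p) (hY : Y.SmoothAt p) (v : TangentSpace I p) :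
    mvfderiv I (fun q ↦ (D.gauge z ζ).K q (X q) (Y q)) p v =
      (z p)⁻¹ * (mvfderiv I (fun q ↦ D.K q (X q) (Y q)) p v
        - (z p)⁻¹ * D.K p (X p) (Y p) * mvfderiv I z p v) := by
  have hi : MDifferentiableAt I 𝓘(ℝ, ℝ) (fun q ↦ (z q)⁻¹) p :=
    ((hz p).inv₀ (hz0 p)).mdifferentiableAt (by simp)
  have hzd : MDifferentiableAt I 𝓘(ℝ, ℝ) z p := (hz p).mdifferentiableAt (by simp)
  have h1 := mvfderiv_mul_apply (v := v) hi (hD.K_mdifferentiableAt hX hY)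
  have h2 := mvfderiv_mul_apply (v := v) hzd hi
  rw [show (fun q ↦ z q * (z q)⁻¹) = fun _ ↦ (1 : ℝ) from
    funext fun q ↦ mul_inv_cancel₀ (hz0 q), mvfderiv_const, zero_apply] at h2
  -- Obtained by differentiating `z z⁻¹ = 1`.
  have h3 : mvfderiv I (fun q ↦ (z q)⁻¹) p v = - ((z p)⁻¹ * (z p)⁻¹ * mvfderiv I z p v) := by
    have := hz0 p
    field_simp
    field_simp at h2
    linear_combination - h2
  simp only [hD.gauge_K hz0 (hz _)]
  rw [h1, h3]
  ring

/-- Of the two quadratic terms, `K(Y, Z) K(ζ, X)` is symmetric in `Y` and `Z` and drops out of the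
antisymmetrization in `A` and `B`. -/
theorem gauge_covDeriv₂_K (hD : D.IsNullHypersurfaceData)
    (hz : ContMDiff I 𝓘(ℝ, ℝ) ∞ z) (hz0 : ∀ p, z p ≠ 0) (hζ : ζ.Smooth)
    (hX : X.SmoothAt p) (hY : Y.SmoothAt p) :
    covDeriv₂ (D.gauge z ζ).connection (D.gauge z ζ).K Z Y X p =
      (z p)⁻¹ * (covDeriv₂ D.connection D.K Z Y X p
        - (z p)⁻¹ * D.K p (Y p) (X p) * mvfderiv I z p (Z p)
        - D.K p (Y p) (Z p) * D.K p (ζ p) (X p) - D.K p (X p) (Z p) * D.K p (ζ p) (Y p)) := by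
  simp only [covDeriv₂]
  rw [hD.mvfderiv_gauge_K hz hz0 hY hX, hD.gauge_connection hz hz0 hζ hX.diffAt,
    hD.gauge_connection hz hz0 hζ hY.diffAt]
  simp only [hD.gauge_K hz0 (hz _), shift_apply, map_add, map_smul, add_apply, smul_apply,
    smul_eq_mul]
  rw [hD.K_symm p (Y p) (ζ p)]
  ring

theorem covDerivProd_K_l (hD : D.IsNullHypersurfaceData)
    (hX : X.SmoothAt p) (hY : Y.SmoothAt p) (hW : W.SmoothAt p) :
    covDerivProd D.connection D.K D.l Z Y X W p =
      covDeriv₂ D.connection D.K Z Y X p * D.l p (W p)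
        + D.K p (Y p) (X p) * covDeriv₁ D.connection D.l Z W p := by
  simp only [covDerivProd, covDeriv₂, covDeriv₁]
  rw [mvfderiv_mul_apply (hD.K_mdifferentiableAt hY hX)
    (hD.smooth_l.mdifferentiableAt_apply hW.diffAt)]
  ring

theorem gauge_covDerivProd_K_l (hD : D.IsNullHypersurfaceData)
    (hz : ContMDiff I 𝓘(ℝ, ℝ) ∞ z) (hz0 : ∀ p, z p ≠ 0) (hζ : ζ.Smooth)
    (hX : X.SmoothAt p) (hY : Y.SmoothAt p) (hW : W.SmoothAt p) :
    covDerivProd (D.gauge z ζ).connection (D.gauge z ζ).K (D.gauge z ζ).l Z Y X W p =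
      covDeriv₂ (D.gauge z ζ).connection (D.gauge z ζ).K Z Y X p * (D.gauge z ζ).l p (W p)
        + (D.gauge z ζ).K p (Y p) (X p) *
          covDeriv₁ (D.gauge z ζ).connection (D.gauge z ζ).l Z W p := by
  have hK : MDifferentiableAt I 𝓘(ℝ, ℝ) (fun q ↦ (D.gauge z ζ).K q (Y q) (X q)) p := by
    simp only [hD.gauge_K hz0 (hz _)]
    exact (((hz p).inv₀ (hz0 p)).mdifferentiableAt (by simp)).mul (hD.K_mdifferentiableAt hY hX)
  simp only [covDerivProd, covDeriv₂, covDeriv₁]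
  rw [mvfderiv_mul_apply hK (gauge_l_diffAt hD.toIsHypersurfaceData hz hζ W hW.diffAt)]
  ring

/-- The derivative of `γ(ζ, W)` coming from `ℓ'` is expanded through `∇γ`, which exposes the term
`γ(∇ζ, W)` needed to cancel its counterpart in the curvature. -/
theorem gauge_covDeriv₁_l (hD : D.IsNullHypersurfaceData)
    (hz : ContMDiff I 𝓘(ℝ, ℝ) ∞ z) (hz0 : ∀ p, z p ≠ 0) (hζ : ζ.Smooth)
    (hZ : Z.DiffAt p) (hW : W.DiffAt p) :
    covDeriv₁ (D.gauge z ζ).connection (D.gauge z ζ).l Z W p =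
      (D.l p (W p) + D.γ p (ζ p) (W p)) * mvfderiv I z p (Z p)
      + z p * (covDeriv₁ D.connection D.l Z W p + D.γ p (D.connection ζ p (Z p)) (W p)
        - D.l p (ζ p) * D.K p (Z p) (W p) - D.l p (W p) * D.K p (Z p) (ζ p)
        - (D.l p (ζ p) + D.γ p (ζ p) (ζ p)) * D.K p (Z p) (W p)) := by
  have hζp : ζ.DiffAt p := (hζ p).mdifferentiableAt (by simp)
  have := hD.isConnection_connection.covDeriv_γ p Z ζ W hZ hζp hW
  simp only [covDeriv₂] at this
  simp only [covDeriv₁]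
  rw [mvfderiv_gauge_l hD.toIsHypersurfaceData hz hζ hW, hD.gauge_connection hz hz0 hζ hW,
    shift_apply, gauge_l_apply]
  simp only [map_add, map_smul, smul_eq_mul]
  rw [hD.K_symm p (W p)]
  linear_combination z p * this

/-- The `dz` terms of `∇'K'` and `∇'ℓ'` cancel each other. The terms with `γ(W, ∇ζ)` and `γ(W, ζ)
∇K` in the curvature cancel against `∇'(K' ⊗ ℓ')`, and the excess `2ℓ(ζ) + γ(ζ, ζ)` in front of the
products of `K` is the change of `ℓ⁽²⁾`. -/
theorem gauge_B (hD : D.IsNullHypersurfaceData)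
    (hz : ContMDiff I 𝓘(ℝ, ℝ) ∞ z) (hz0 : ∀ p, z p ≠ 0) (hζ : ζ.Smooth)
    (hW : W.SmoothAt p) (hX : X.SmoothAt p) (hY : Y.SmoothAt p) (hZ : Z.SmoothAt p) :
    (D.gauge z ζ).B W X Y Z p = D.B W X Y Z p := by
  simp only [B]
  rw [hD.gauge_covDerivProd_K_l hz hz0 hζ hX hY hW, hD.gauge_covDerivProd_K_l hz hz0 hζ hX hZ hW,
    hD.covDerivProd_K_l hX hY hW, hD.covDerivProd_K_l hX hZ hW,
    hD.gauge_covDeriv₂_K hz hz0 hζ hX hY, hD.gauge_covDeriv₂_K hz hz0 hζ hX hZ,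
    hD.gauge_covDeriv₁_l hz hz0 hζ hY.diffAt hW.diffAt,
    hD.gauge_covDeriv₁_l hz hz0 hζ hZ.diffAt hW.diffAt,
    hD.gauge_curvature hz hz0 hζ hX hY hZ]
  simp only [hD.gauge_K hz0 (hz _), gauge_γ, gauge_l_apply, gauge_l2_apply, map_add, map_sub,
    map_smul, smul_eq_mul]
  rw [hD.K_symm p (Z p) (Y p), hD.K_symm p (Y p) (X p), hD.K_symm p (Z p) (X p),
    hD.K_symm p (Y p) (ζ p), hD.K_symm p (Z p) (ζ p), hD.symm_γ p (W p) (ζ p),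
    hD.symm_γ p (W p) (D.connection ζ p (Y p)), hD.symm_γ p (W p) (D.connection ζ p (Z p))]
  have := hz0 p
  field_simp
  ring

theorem gauge_A (hD : D.IsNullHypersurfaceData)
    (hz : ContMDiff I 𝓘(ℝ, ℝ) ∞ z) (hz0 : ∀ p, z p ≠ 0) (hζ : ζ.Smooth)
    (hX : X.SmoothAt p) (hY : Y.SmoothAt p) (hZ : Z.SmoothAt p) :
    (D.gauge z ζ).A X Y Z p = z p * (D.A X Y Z p + D.B ζ X Y Z p) := by
  have hζp : ζ.DiffAt p := (hζ p).mdifferentiableAt (by simp)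
  have g1 := hD.isConnection_connection.covDeriv_γ p Y ζ ζ hY.diffAt hζp hζp
  have g2 := hD.isConnection_connection.covDeriv_γ p Z ζ ζ hZ.diffAt hζp hζp
  simp only [covDeriv₂] at g1 g2
  rw [hD.symm_γ p (ζ p) (D.connection ζ p _)] at g1 g2
  simp only [A, B]
  rw [hD.covDerivProd_K_l hX hY (hζ p), hD.covDerivProd_K_l hX hZ (hζ p),
    hD.gauge_covDeriv₂_K hz hz0 hζ hX hY, hD.gauge_covDeriv₂_K hz hz0 hζ hX hZ,
    hD.gauge_curvature hz hz0 hζ hX hY hZ, mvfderiv_gauge_l2 hD.toIsHypersurfaceData hz hζ,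
    mvfderiv_gauge_l2 hD.toIsHypersurfaceData hz hζ]
  simp only [hD.gauge_K hz0 (hz _), gauge_l_apply, gauge_l2_apply, map_add, map_sub,
    map_smul, smul_eq_mul, covDeriv₁]
  rw [hD.K_symm p (Y p) (ζ p)] at g1
  rw [hD.K_symm p (Z p) (ζ p)] at g2
  rw [hD.K_symm p (Z p) (Y p), hD.K_symm p (Y p) (X p), hD.K_symm p (Z p) (X p),
    hD.K_symm p (Y p) (ζ p), hD.K_symm p (Z p) (ζ p),
    hD.symm_γ p (ζ p) (D.connection ζ p (Y p)), hD.symm_γ p (ζ p) (D.connection ζ p (Z p))]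
  have := hz0 p
  field_simp
  -- The derivative of `ℓ⁽²⁾'` contains that of `γ(ζ, ζ)`; `g1` and `g2` trade it for `2γ(∇ζ, ζ)`
  -- and a `K` term, matching the curvature.
  linear_combination z p * (D.K p (X p) (Y p) * g2 - D.K p (X p) (Z p) * g1)

end Tuple.IsNullHypersurfaceData

end GaugeCurvature

end HypersurfaceData

end

theorem mainTheorem5 {E : Type*} [NormedAddCommGroup E] [NormedSpace ℝ E] [FiniteDimensional ℝ E]
    {H : Type*} [TopologicalSpace H] {I : ModelWithCorners ℝ E H}
    {M : Type*} [TopologicalSpace M] [ChartedSpace H M] [IsManifold I ∞ M]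
    (D : HypersurfaceData.Tuple I M) (hD : D.IsNullHypersurfaceData)
    (z : M → ℝ) (hz : ContMDiff I 𝓘(ℝ, ℝ) ∞ z) (hz0 : ∀ p, z p ≠ 0)
    (ζ : HypersurfaceData.VField I M) (hζ : ζ.Smooth) :
    (∀ (p : M) (X Y Z : HypersurfaceData.VField I M),
      X.SmoothAt p → Y.SmoothAt p → Z.SmoothAt p →
        (D.gauge z ζ).A X Y Z p = z p * (D.A X Y Z p + D.B ζ X Y Z p)) ∧
    (∀ (p : M) (W X Y Z : HypersurfaceData.VField I M),
      W.SmoothAt p → X.SmoothAt p → Y.SmoothAt p → Z.SmoothAt p →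
        (D.gauge z ζ).B W X Y Z p = D.B W X Y Z p) :=
  ⟨fun _ _ _ _ hX hY hZ ↦ hD.gauge_A hz hz0 hζ hX hY hZ,
    fun _ _ _ _ _ hW hX hY hZ ↦ hD.gauge_B hz hz0 hζ hW hX hY hZ⟩
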